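/- For $n\ge 0$ let $\mathcal{S}_n(123)$ denote the set of permutations $\pi=\pi_1\pi_2\cdots\pi_n$ of $\{1,\dots,n\}$ that avoid the pattern $123$, that is, for which there are no indices $i_1<i_2<i_3$ with $\pi_{i_1}<\pi_{i_2}<\pi_{i_3}$. Let $s_n^2(123)$ be the number of $\pi\in\mathcal{S}_n(123)$ that have exactly two fixed points (a fixed point is an $i$ with $\pi_i=i$). Then $$s_n^2(123)=\sum_{i=1}^{n-1}\ \sum_{r,s=1}^{i}\left[\left(\binom{2i-r-1}{i-1}-\binom{2i-r-1}{i}\right)\left(\binom{2i-s-1}{i-1}-\binom{2i-s-1}{i}\right)\sum_{\substack{1\le h\le n\\ n-h\ \mathrm{even}}}\ \sum_{k=0}^{n-2i} f(k,r,h,n-2i+r)\, f(n-2i-k,s,h,n-2i+s)\right],$$ where $$f(k,r,h,\ell)=\begin{cases}\dbinom{\frac{\ell+h-r}{2}-1}{k}\dbinom{\frac{\ell-h+r}{2}-1}{k-1}-\dbinom{\frac{\ell-h-r}{2}-1}{k}\dbinom{\frac{\ell+h+r}{2}-1}{k-1} & \text{if } k\ge 1,\\[2mm] 1 & \text{if }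 k=0 \text{ and } \ell=h-r,\\ 0 & \text{otherwise,}\end{cases}$$ with the convention $\binom{a}{b}:=0$ if $a<0$. A sum whose upper limit is smaller than its lower limit is empty, that is, equal to $0$. -/

import Mathlib

open scoped BigOperators

/-- The permutation `π` of `Fin n` contains the pattern `σ`: there are positions
`i_1 < i_2 < ... < i_m` such that the values of `π` at these positions are in the same relative
order as the values of `σ`. -/
def ContainsPattern {n m : ℕ} (π : Equiv.Perm (Fin n)) (σ : Equiv.Perm (Fin m)) : Prop :=
  ∃ e : Fin m → Fin n, StrictMono e ∧ ∀ a b : Fin m, π (e a) < π (e b) ↔ σ a < σ b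

/-- The permutation `π` avoids the pattern `σ`. -/
def AvoidsPattern {n m : ℕ} (π : Equiv.Perm (Fin n)) (σ : Equiv.Perm (Fin m)) : Prop :=
  ¬ ContainsPattern π σ

/-- The pattern `123`, that is, the identity permutation of three letters. -/
def pattern123 : Equiv.Perm (Fin 3) := Equiv.refl (Fin 3)

/-- The number of fixed points of a permutation. -/
def numFixedPoints {n : ℕ} (π : Equiv.Perm (Fin n)) : ℕ :=
  (Finset.univ.filter fun i : Fin n => π i = i).card

/-- `avoidersWithFixedPoints n k σ` is `s_n^k(σ)`, the number of `σ`-avoiding permutations of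
length `n` with exactly `k` fixed points. -/
noncomputable def avoidersWithFixedPoints {m : ℕ} (n k : ℕ) (σ : Equiv.Perm (Fin m)) : ℕ :=
  Set.ncard {π : Equiv.Perm (Fin n) | AvoidsPattern π σ ∧ numFixedPoints π = k}

/-- The binomial coefficient `a` over `b` for integers `a` and `b`, equal to `0` if `a < 0`
(and also, as usual, if `b < 0` or `b > a`). -/
def intBinom (a b : ℤ) : ℤ :=
  if a < 0 ∨ b < 0 then 0 else (a.toNat.choose b.toNat : ℤ)

/-- The function `f(k, r, h, ℓ)`. It is only used for `ℓ + h - r` even, in which case all the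
divisions by `2` below are exact. -/
def pathCount (k r h l : ℤ) : ℤ :=
  if 1 ≤ k then
    intBinom ((l + h - r) / 2 - 1) k * intBinom ((l - h + r) / 2 - 1) (k - 1)
      - intBinom ((l - h - r) / 2 - 1) k * intBinom ((l + h + r) / 2 - 1) (k - 1)
  else if k = 0 ∧ l = h - r then 1
  else 0

/-!
Why the formula holds. Draw `π` as the set of cells `(x, π x)`. In a `123`-avoiding permutation the
left-to-right minima form a decreasing sequence, and so do the remaining entries, so `π` is
determined by the boundary path running just below and to the left of its left-to-right minima. Read
from the top left corner to the bottom right corner, with a rise for each row passed and a fall for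
each column passed, this is a Dyck path with `2n` steps; its peaks are the left-to-right minima, and
every Dyck path occurs (`exists_stepWord_eq`, `exists_avoids123_of_antitone`,
`Avoids123.eq_of_runMin_eq`).

Two fixed points form an ascent, so one of them is a left-to-right minimum and the other one is not,
and there is at most one fixed point of each kind (`numFixedPoints_eq_two_iff`).

* There is a fixed left-to-right minimum exactly when the path has a peak on the central line
  (`exists_fixed_isLRMin_iff`). Cut the path there: transposing `π` reverses the path
  (`stepWord_symm`), so the path is a pair of ballot paths `L`, `R` with `n` steps, ending at the
  same height with a rise, where `L` comes from `π` and `R` from `π⁻¹`.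
* The entries which are not minima match the rows and the columns without peaks in order. If
  there is a fixed minimum, comparing ranks shows that `b` is a fixed point which is not a minimum
  if and only if, with `i = n - b` (positions start at `0`), in both `L` and `R` the `i`-th rise is followed by a rise, and beyond the `i`-th
  rises the two halves have together `n - 2i` peaks (`fixed_iff_words`).

Now count the pairs `(L, R)` for each `i`. The part of `L` up to the `i`-th rise, ending at height
`r`, is counted by a ballot number (`numWords_riseEnding`); the rest, from height `r` to the final
height `h` with `k` peaks, is counted by `pathCount`. The latter is proved by induction on the
number of steps (`numUp_and_numDown`): the closed forms satisfy the same recursion as the words, by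
Pascal's rule, and vanish at the boundary because the reflected term cancels the first one there.
-/

/-! ### Counting ballot words -/

/-- The words of length `n`; `true` is a rise and `false` is a fall. Throughout, a word is stored in
reverse: the head of the list is the last step of the path. -/
def boolWords : ℕ → Finset (List Bool)
  | 0 => {[]}
  | n + 1 => (boolWords n).image (List.cons true) ∪ (boolWords n).image (List.cons false)

lemma mem_boolWords {n : ℕ} {l : List Bool} : l ∈ boolWords n ↔ l.length = n := by
  induction n generalizing l with
  | zero => simp [boolWords]
  | succ n ih =>
    rcases l with _ | ⟨x, l⟩
    · simp [boolWords]
    · cases x <;> simp [boolWords, ih]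

open Classical in
lemma card_filter_boolWords_succ (n : ℕ) (P : List Bool → Prop) :
    ((boolWords (n + 1)).filter P).card =
      ((boolWords n).filter fun l => P (true :: l)).card +
        ((boolWords n).filter fun l => P (false :: l)).card := by
  rw [boolWords, Finset.filter_union, Finset.card_union_of_disjoint]
  · rw [Finset.filter_image, Finset.filter_image,
      Finset.card_image_of_injective _ (List.cons_injective),
      Finset.card_image_of_injective _ (List.cons_injective)]
  · rw [Finset.disjoint_left]
    intro l h1 h2
    simp only [Finset.mem_filter, Finset.mem_image] at h1 h2
    obtain ⟨⟨a, -, rfl⟩, -⟩ := h1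
    obtain ⟨⟨b, -, h⟩, -⟩ := h2
    simp at h

/-- The path never goes below its starting height. -/
def IsBallot : List Bool → Prop
  | [] => True
  | x :: l => IsBallot l ∧ (x :: l).count false ≤ (x :: l).count true

lemma IsBallot.count_le {l : List Bool} (h : IsBallot l) : l.count false ≤ l.count true := by
  cases l with
  | nil => simp
  | cons x l => exact h.2

/-- The `i`-th rise of the path is directly followed by another rise. -/
def HasDoubleRise (i : ℕ) : List Bool → Prop
  | [] => False
  | x :: l => HasDoubleRise i l ∨ (x = true ∧ l.head? = some true ∧ l.count true = i)

/-- The number of peaks (a rise followed by a fall) whose rise comes after the `i`-th rise. -/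
def latePeaks (i : ℕ) : List Bool → ℕ
  | [] => 0
  | x :: l => latePeaks i l +
      if x = false ∧ l.head? = some true ∧ i < l.count true then 1 else 0

lemma HasDoubleRise.lt_count {i : ℕ} {l : List Bool} (h : HasDoubleRise i l) :
    i < l.count true := by
  induction l with
  | nil => exact h.elim
  | cons x l ih =>
    rcases h with h | ⟨rfl, -, h⟩
    · have := ih h
      have : l.count true ≤ (x :: l).count true := List.count_le_count_cons
      omega
    · simp [h]

lemma latePeaks_eq_zero {i : ℕ} {l : List Bool} (h : l.count true ≤ i) : latePeaks i l = 0 := by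
  induction l with
  | nil => rfl
  | cons x l ih =>
    have : l.count true ≤ (x :: l).count true := List.count_le_count_cons
    have := ih (by omega)
    simp only [latePeaks, this]
    rw [if_neg (by rintro ⟨-, -, h⟩; omega)]

/-- Ballot words with `u` rises and `d` falls. -/
def IsBallotWith (u d : ℕ) (l : List Bool) : Prop :=
  IsBallot l ∧ l.count true = u ∧ l.count false = d

/-- Ballot words with `u` rises and `d` falls whose last step is a rise. -/
def IsRiseEnding (u d : ℕ) (l : List Bool) : Prop :=
  IsBallotWith u d l ∧ l.head? = some true

/-- Ballot words with `u` rises and `d` falls, ending with a rise, whose `i`-th rise is followed by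
a rise, and which have `k` peaks after the `i`-th rise. -/
def IsUpWord (i k u d : ℕ) (l : List Bool) : Prop :=
  IsBallotWith u d l ∧ l.head? = some true ∧ HasDoubleRise i l ∧ latePeaks i l = k

/-- The analogue of `IsUpWord` for words ending with a fall. -/
def IsDownWord (i k u d : ℕ) (l : List Bool) : Prop :=
  IsBallotWith u d l ∧ l.head? = some false ∧ HasDoubleRise i l ∧ latePeaks i l = k

open Classical in
/-- The number of words of length `n` satisfying `P`. -/
noncomputable def numWords (n : ℕ) (P : List Bool → Prop) : ℕ := ((boolWords n).filter P).card

lemma numWords_succ (n : ℕ) (P : List Bool → Prop) :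
    numWords (n + 1) P =
      numWords n (fun l => P (true :: l)) + numWords n (fun l => P (false :: l)) :=
  card_filter_boolWords_succ n P

lemma numWords_congr {n : ℕ} {P Q : List Bool → Prop} (h : ∀ l, P l ↔ Q l) :
    numWords n P = numWords n Q := by
  rw [show P = Q from funext fun l => propext (h l)]

lemma numWords_eq_zero {n : ℕ} {P : List Bool → Prop} (h : ∀ l, ¬ P l) : numWords n P = 0 := by
  classical
  simp [numWords, h]

lemma numWords_or {n : ℕ} {P Q : List Bool → Prop} (h : ∀ l, P l → ¬ Q l) :
    numWords n (fun l => P l ∨ Q l) = numWords n P + numWords n Q := by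
  classical
  have h' : Disjoint ((boolWords n).filter P) ((boolWords n).filter Q) :=
    Finset.disjoint_filter.2 fun l _ => h l
  unfold numWords
  rw [← Finset.card_union_of_disjoint (by convert h'), ← Finset.filter_or]
  congr!

lemma isBallotWith_cons_true (u d : ℕ) (l : List Bool) :
    IsBallotWith u d (true :: l) ↔ ∃ v, u = v + 1 ∧ IsBallotWith v d l := by
  constructor
  · rintro ⟨⟨h1, -⟩, h2, h3⟩
    simp at h2 h3
    exact ⟨_, h2.symm, h1, rfl, h3⟩
  · rintro ⟨v, rfl, h1, rfl, rfl⟩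
    have := h1.count_le
    refine ⟨⟨h1, ?_⟩, ?_, ?_⟩ <;> simp
    omega

lemma isBallotWith_cons_false (u d : ℕ) (l : List Bool) :
    IsBallotWith u d (false :: l) ↔ ∃ c, d = c + 1 ∧ c < u ∧ IsBallotWith u c l := by
  constructor
  · rintro ⟨⟨h1, h⟩, h2, h3⟩
    simp at h h2 h3
    exact ⟨_, h3.symm, by omega, h1, h2, rfl⟩
  · rintro ⟨v, rfl, h, h1, rfl, rfl⟩
    refine ⟨⟨h1, ?_⟩, ?_, ?_⟩ <;> simp
    omega

lemma numWords_ballot_zero : numWords 0 (IsBallotWith 0 0) = 1 := by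
  classical
  simp [numWords, boolWords, Finset.filter_singleton, IsBallotWith, IsBallot]

lemma IsBallotWith.le {u d : ℕ} {l : List Bool} (h : IsBallotWith u d l) : d ≤ u := by
  obtain ⟨h, rfl, rfl⟩ := h
  exact h.count_le

lemma IsBallotWith.lt {u d : ℕ} {l : List Bool} (h : IsBallotWith u d l)
    (h1 : l.head? = some true) : d < u := by
  rcases l with _ | ⟨x, l⟩
  · simp at h1
  · obtain rfl : x = true := by simpa using h1
    rw [isBallotWith_cons_true] at h
    obtain ⟨v, rfl, h⟩ := h
    have := h.le
    omega

/-- The ballot numbers. The formula also holds, with value `0`, on the line `d = u + 1`, which is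
what makes the induction work. -/
lemma numWords_ballot (u d : ℕ) (h : d ≤ u + 1) :
    (numWords (u + d) (IsBallotWith u d) : ℤ) = (u + d).choose u - (u + d).choose (u + 1) := by
  induction hN : u + d generalizing u d with
  | zero =>
    obtain ⟨rfl, rfl⟩ : u = 0 ∧ d = 0 := by omega
    simp [numWords_ballot_zero]
  | succ N ih =>
    rcases Nat.eq_or_lt_of_le h with rfl | h
    · rw [numWords_eq_zero (fun l hl => by have := hl.le; omega)]
      rw [show N + 1 = 2 * u + 1 by omega, Nat.choose_symm_half]
      simp
    rw [numWords_succ]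
    push_cast
    rcases u with _ | u
    · omega
    rw [numWords_congr (Q := IsBallotWith u d)
      (fun l => by rw [isBallotWith_cons_true]; constructor
                   · rintro ⟨v, hv, h⟩
                     obtain rfl : u = v := by omega
                     exact h
                   · exact fun h => ⟨_, rfl, h⟩)]
    rw [ih u d (by omega) (by omega)]
    rcases d with _ | d
    · rw [numWords_eq_zero (fun l hl => by
        rw [isBallotWith_cons_false] at hl; obtain ⟨c, hc, -⟩ := hl; omega)]
      obtain rfl : N = u := by omega
      simp
    rw [numWords_congr (Q := IsBallotWith (u + 1) d)
      (fun l => by rw [isBallotWith_cons_false]; constructor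
                   · rintro ⟨v, hv, -, h⟩
                     obtain rfl : d = v := by omega
                     exact h
                   · exact fun h => ⟨_, rfl, by omega, h⟩)]
    rw [ih (u + 1) d (by omega) (by omega), Nat.choose_succ_succ N u,
      Nat.choose_succ_succ N (u + 1)]
    push_cast
    ring

lemma numWords_riseEnding (i e : ℕ) (h : e ≤ i + 1) :
    (numWords (i + 1 + e) (IsRiseEnding (i + 1) e) : ℤ) =
      (i + e).choose i - (i + e).choose (i + 1) := by
  rw [show i + 1 + e = i + e + 1 by omega, numWords_succ, ← numWords_ballot i e h]
  rw [numWords_eq_zero (P := fun l => IsRiseEnding _ _ (false :: l)) (by simp [IsRiseEnding]),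
    add_zero]
  congr 1
  apply numWords_congr
  intro l
  simp [IsRiseEnding, isBallotWith_cons_true]

lemma isUpWord_cons_true (i k u d : ℕ) (l : List Bool) :
    IsUpWord i k (u + 1) d (true :: l) ↔
      (IsUpWord i k u d l ∨ IsDownWord i k u d l) ∨ (k = 0 ∧ u = i ∧ IsRiseEnding u d l) := by
  have hk : latePeaks i (true :: l) = latePeaks i l := by simp [latePeaks]
  unfold IsUpWord IsDownWord IsRiseEnding
  rw [isBallotWith_cons_true, hk]
  constructor
  · rintro ⟨⟨v, hv, h⟩, -, h1, h2⟩
    obtain rfl : u = v := by omega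
    rcases h1 with h1 | ⟨-, h1, h3⟩
    · left
      rcases l with _ | ⟨x, l⟩
      · exact h1.elim
      · cases x
        · exact .inr ⟨h, rfl, h1, h2⟩
        · exact .inl ⟨h, rfl, h1, h2⟩
    · right
      rw [latePeaks_eq_zero h3.le] at h2
      exact ⟨h2.symm, h.2.1.symm.trans h3, h, h1⟩
  · rintro ((⟨h, h1, h2, h3⟩ | ⟨h, h1, h2, h3⟩) | ⟨rfl, rfl, h, h1⟩)
    · exact ⟨⟨u, rfl, h⟩, rfl, .inl h2, h3⟩
    · exact ⟨⟨u, rfl, h⟩, rfl, .inl h2, h3⟩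
    · exact ⟨⟨u, rfl, h⟩, rfl, .inr ⟨rfl, h1, h.2.1⟩, latePeaks_eq_zero h.2.1.le⟩

lemma isDownWord_cons_false (i k u d : ℕ) (hd : d < u) (l : List Bool) :
    IsDownWord i k u (d + 1) (false :: l) ↔
      IsDownWord i k u d l ∨ (k ≠ 0 ∧ IsUpWord i (k - 1) u d l) := by
  have hH : HasDoubleRise i (false :: l) ↔ HasDoubleRise i l := by simp [HasDoubleRise]
  unfold IsUpWord IsDownWord
  rw [isBallotWith_cons_false, hH]
  constructor
  · rintro ⟨⟨v, hv, -, h⟩, -, h1, h2⟩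
    obtain rfl : d = v := by omega
    have h3 := h1.lt_count
    rcases l with _ | ⟨x, l⟩
    · exact h1.elim
    · rw [latePeaks] at h2
      cases x
      · left
        rw [if_neg (by simp)] at h2
        exact ⟨h, rfl, h1, h2⟩
      · right
        rw [if_pos ⟨rfl, rfl, h3⟩] at h2
        exact ⟨by omega, h, rfl, h1, by omega⟩
  · rintro (⟨h, h1, h2, h3⟩ | ⟨hk, h, h1, h2, h3⟩)
    · refine ⟨⟨d, rfl, hd, h⟩, rfl, h2, ?_⟩
      rw [latePeaks, h1, if_neg (by simp)]
      exact h3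
    · refine ⟨⟨d, rfl, hd, h⟩, rfl, h2, ?_⟩
      rw [latePeaks, h1, if_pos ⟨rfl, rfl, h2.lt_count⟩]
      omega

lemma numUp_succ (i k u d : ℕ) :
    numWords (u + 1 + d) (IsUpWord i k (u + 1) d) =
      numWords (u + d) (IsUpWord i k u d) + numWords (u + d) (IsDownWord i k u d) +
        if k = 0 ∧ u = i then numWords (u + d) (IsRiseEnding u d) else 0 := by
  rw [show u + 1 + d = u + d + 1 by omega, numWords_succ,
    numWords_eq_zero (P := fun l => IsUpWord _ _ _ _ (false :: l)) (by simp [IsUpWord]), add_zero,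
    numWords_congr (isUpWord_cons_true i k u d), numWords_or, numWords_or]
  · congr 1
    split_ifs with h
    · exact numWords_congr fun l => by simp [h]
    · exact numWords_eq_zero fun l hl => h ⟨hl.1, hl.2.1⟩
  · rintro l ⟨-, h, -⟩ ⟨-, h', -⟩
    simp [h] at h'
  · rintro l h ⟨rfl, rfl, h'⟩
    have h1 : HasDoubleRise u l := by rcases h with h | h <;> exact h.2.2.1
    have := h1.lt_count
    have := h'.1.2.1
    omega

lemma numDown_succ (i k u d : ℕ) (hd : d < u) :
    numWords (u + (d + 1)) (IsDownWord i k u (d + 1)) =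
      numWords (u + d) (IsDownWord i k u d) +
        if k = 0 then 0 else numWords (u + d) (IsUpWord i (k - 1) u d) := by
  rw [← add_assoc, numWords_succ,
    numWords_eq_zero (P := fun l => IsDownWord _ _ _ _ (true :: l)) (by simp [IsDownWord]),
    zero_add,
    numWords_congr (isDownWord_cons_false i k u d hd), numWords_or]
  · congr 1
    split_ifs with h
    · exact numWords_eq_zero fun l hl => hl.1 h
    · exact numWords_congr fun l => by simp [h]
  · rintro l ⟨-, h, -⟩ ⟨-, -, h', -⟩
    simp [h] at h'

/-- The number of ways to continue a ballot word with `i` rises and `e` falls that ends with its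
`i`-th rise to an `IsUpWord i k u d`. For `k ≥ 1` the first product counts the continuations without
the ballot condition, by cutting the rises into `k + 1` runs and the falls into `k` runs. The second
one is its image under the reflection exchanging `u` and `d`. -/
def upCount (i e k u d : ℤ) : ℤ :=
  if 1 ≤ k then
    intBinom (u - i - 1) k * intBinom (d - e - 1) (k - 1)
      - intBinom (d - i - 1) k * intBinom (u - e - 1) (k - 1)
  else if d = e ∧ i < u then 1 else 0

/-- The analogue of `upCount` for continuations to an `IsDownWord i k u d`. -/
def downCount (i e k u d : ℤ) : ℤ :=
  if 1 ≤ k then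
    intBinom (u - i - 1) (k - 1) * intBinom (d - e - 1) (k - 1)
      - intBinom (d - i - 1) k * intBinom (u - e - 1) (k - 2)
  else 0

lemma intBinom_of_neg_left {a b : ℤ} (h : a < 0) : intBinom a b = 0 := by simp [intBinom, h]
lemma intBinom_of_neg_right {a b : ℤ} (h : b < 0) : intBinom a b = 0 := by simp [intBinom, h]
lemma intBinom_zero_right {a : ℤ} (h : 0 ≤ a) : intBinom a 0 = 1 := by
  simp [intBinom, not_lt.2 h]
lemma intBinom_natCast (a b : ℕ) : intBinom a b = (a.choose b : ℤ) := by
  rw [intBinom, if_neg (by omega)]; simp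

/-- Pascal's rule. With the convention that `intBinom a b` vanishes for `a < 0` it fails only at
`a = -1`, `b = 0`. -/
lemma intBinom_pascal (a b : ℤ) (h : b ≠ 0 ∨ 0 ≤ a ∨ a + 1 < 0) :
    intBinom (a + 1) b = intBinom a b + intBinom a (b - 1) := by
  rcases lt_trichotomy b 0 with hb | rfl | hb
  · rw [intBinom_of_neg_right hb, intBinom_of_neg_right hb, intBinom_of_neg_right (by omega)]; rfl
  · rw [intBinom_of_neg_right (b := 0 - 1) (by omega), add_zero]
    rcases h with h | h | h
    · exact absurd rfl h
    · rw [intBinom_zero_right h, intBinom_zero_right (by omega)]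
    · rw [intBinom_of_neg_left h, intBinom_of_neg_left (by omega)]
  · rcases lt_trichotomy (a + 1) 0 with ha | ha | ha
    · rw [intBinom_of_neg_left ha, intBinom_of_neg_left (by omega),
        intBinom_of_neg_left (by omega)]
      rfl
    · rw [intBinom_of_neg_left (a := a) (by omega), intBinom_of_neg_left (a := a) (by omega), ha]
      obtain ⟨c, rfl⟩ : ∃ c : ℕ, b = (c + 1 : ℕ) := ⟨(b - 1).toNat, by omega⟩
      exact_mod_cast intBinom_natCast 0 (c + 1)
    · obtain ⟨c, rfl⟩ : ∃ c : ℕ, b = (c + 1 : ℕ) := ⟨(b - 1).toNat, by omega⟩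
      obtain ⟨a, rfl⟩ : ∃ c : ℕ, a = (c : ℕ) := ⟨a.toNat, by omega⟩
      rw [show (a : ℤ) + 1 = (a + 1 : ℕ) by push_cast; rfl,
        show ((c + 1 : ℕ) : ℤ) - 1 = (c : ℕ) by push_cast; ring, intBinom_natCast, intBinom_natCast,
        intBinom_natCast, Nat.choose_succ_succ]
      push_cast; ring

lemma upCount_succ (i e k u d : ℤ) (he : e < i) (hk : 0 ≤ k) (hd : d ≤ u) :
    upCount i e k (u + 1) d = upCount i e k u d + downCount i e k u d +
      if k = 0 ∧ u = i then (if d = e then 1 else 0) else 0 := by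
  unfold upCount downCount
  rcases hk.eq_or_lt with rfl | hk
  · by_cases h1 : d = e <;> by_cases h2 : u = i <;> simp [h1, h2]
    rcases lt_or_gt_of_ne h2 with h | h
    · rw [if_neg (by omega), if_neg (by omega)]
    · rw [if_pos (by omega), if_pos (by omega)]
  · rw [if_pos (by omega), if_pos (by omega), if_pos (by omega), if_neg (by omega),
      show u + 1 - i - 1 = u - i - 1 + 1 by ring, show u + 1 - e - 1 = u - e - 1 + 1 by ring,
      intBinom_pascal (u - i - 1) k (by omega)]
    by_cases h : 0 ≤ d - i - 1
    · rw [intBinom_pascal (u - e - 1) (k - 1) (by omega), show k - 1 - 1 = k - 2 by ring]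
      ring
    · rw [intBinom_of_neg_left (a := d - i - 1) (by omega)]
      ring

lemma downCount_succ (i e k u d : ℤ) (hk : 0 ≤ k) :
    downCount i e k u (d + 1) = downCount i e k u d +
      if k = 0 then 0 else upCount i e (k - 1) u d := by
  unfold upCount downCount
  rcases hk.eq_or_lt with rfl | hk
  · simp
  · rw [if_pos (by omega), if_pos (by omega), if_neg (by omega)]
    rcases eq_or_lt_of_le (Int.add_one_le_iff.2 hk) with h1 | h1
    · obtain rfl : k = 1 := by omega
      simp only [sub_self, show (1 : ℤ) - 2 = -1 by norm_num,
        intBinom_of_neg_right (b := -1) (by norm_num)]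
      by_cases h2 : i < u
      · rw [intBinom_zero_right (a := u - i - 1) (by omega)]
        rcases lt_trichotomy d e with h | h | h
        · rw [intBinom_of_neg_left (a := d + 1 - e - 1) (by omega),
            intBinom_of_neg_left (a := d - e - 1) (by omega), if_neg (by omega), if_neg (by omega)]
          ring
        · rw [intBinom_zero_right (a := d + 1 - e - 1) (by omega),
            intBinom_of_neg_left (a := d - e - 1) (by omega), if_neg (by omega), if_pos ⟨h, h2⟩]
          ring
        · rw [intBinom_zero_right (a := d + 1 - e - 1) (by omega),
            intBinom_zero_right (a := d - e - 1) (by omega), if_neg (by omega), if_neg (by omega)]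
          ring
      · rw [intBinom_of_neg_left (a := u - i - 1) (by omega)]
        simp [h2]
    · rw [if_pos (by omega), show d + 1 - e - 1 = d - e - 1 + 1 by ring,
        show d + 1 - i - 1 = d - i - 1 + 1 by ring, intBinom_pascal (d - e - 1) (k - 1) (by omega),
        intBinom_pascal (d - i - 1) k (by omega), show k - 1 - 1 = k - 2 by ring]
      ring

/-- On the line `u = d` the reflected term cancels the first one: a word ending with a rise cannot
end at height `0`. -/
lemma upCount_diag (i e k u : ℤ) (he : e < i) : upCount i e k u u = 0 := by
  unfold upCount
  split_ifs
  · ring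
  · omega
  · rfl

lemma upCount_of_le (i e k u d : ℤ) (hd : d ≤ u) (hu : u ≤ i) : upCount i e k u d = 0 := by
  unfold upCount
  rw [intBinom_of_neg_left (a := u - i - 1) (by omega),
    intBinom_of_neg_left (a := d - i - 1) (by omega),
    if_neg (by omega : ¬ (d = e ∧ i < u))]
  simp

lemma downCount_zero (i e k u : ℤ) (he : 0 ≤ e) (hi : 0 ≤ i) : downCount i e k u 0 = 0 := by
  unfold downCount
  rw [intBinom_of_neg_left (a := 0 - e - 1) (by omega),
    intBinom_of_neg_left (a := 0 - i - 1) (by omega)]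
  simp

/-- Words whose `i`-th rise is followed by a rise, counted according to the number `e` of falls
before the `i`-th rise. -/
theorem numUp_and_numDown (i u d k : ℕ) (hd : d ≤ u) :
    (numWords (u + d) (IsUpWord i k u d) : ℤ) =
        ∑ e ∈ Finset.range i, (numWords (i + e) (IsRiseEnding i e) : ℤ) * upCount i e k u d ∧
    (numWords (u + d) (IsDownWord i k u d) : ℤ) =
        ∑ e ∈ Finset.range i, (numWords (i + e) (IsRiseEnding i e) : ℤ) * downCount i e k u d := by
  induction hN : u + d generalizing u d k with
  | zero =>
    obtain ⟨rfl, rfl⟩ : u = 0 ∧ d = 0 := by omega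
    constructor
    · rw [Finset.sum_eq_zero]
      · rw [numWords_eq_zero]; · rfl
        rintro l ⟨⟨-, h, -⟩, -, h', -⟩
        have := h'.lt_count; omega
      · intro e _
        rw [upCount_of_le] <;> simp
    · rw [Finset.sum_eq_zero]
      · rw [numWords_eq_zero]; · rfl
        rintro l ⟨⟨-, h, -⟩, -, h', -⟩
        have := h'.lt_count; omega
      · intro e _
        rw [Nat.cast_zero, downCount_zero] <;> simp
  | succ N ih =>
    constructor
    · rcases hd.eq_or_lt with rfl | hd
      · rw [numWords_eq_zero, Finset.sum_eq_zero]
        · rfl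
        · intro e he
          rw [upCount_diag _ _ _ _ (by exact_mod_cast Finset.mem_range.1 he), mul_zero]
        · rintro l ⟨h, h1, -, -⟩
          have := h.lt h1
          omega
      · obtain ⟨u, rfl⟩ : ∃ v, u = v + 1 := ⟨u - 1, by omega⟩
        rw [← hN, numUp_succ]
        have hd' : d ≤ u := by omega
        obtain rfl : N = u + d := by omega
        push_cast
        rw [(ih u d k hd' rfl).1, (ih u d k hd' rfl).2]
        have hs := Finset.sum_congr (s₁ := Finset.range i) rfl fun e he =>
          congrArg ((numWords (i + e) (IsRiseEnding i e) : ℤ) * ·)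
            (upCount_succ i e k u d (by exact_mod_cast Finset.mem_range.1 he) (by omega)
              (by exact_mod_cast hd'))
        simp only [mul_add, Finset.sum_add_distrib] at hs
        rw [hs]
        congr 1
        by_cases h : k = 0 ∧ u = i
        · obtain ⟨rfl, rfl⟩ := h
          simp only [Nat.cast_inj, and_self, if_true, Nat.cast_zero, mul_ite, mul_one, mul_zero]
          rw [Finset.sum_ite_eq]
          split_ifs with h'
          · rfl
          · rw [Finset.mem_range] at h'
            rw [numWords_eq_zero]
            · rfl
            rintro l ⟨h, h1⟩
            have := h.lt h1
            omega
        · rw [if_neg h, Finset.sum_eq_zero]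
          intro e _
          rw [if_neg (by exact_mod_cast h), mul_zero]
    · rcases d with _ | d
      · rw [numWords_eq_zero, Finset.sum_eq_zero]
        · rfl
        · intro e he
          rw [Nat.cast_zero, downCount_zero _ _ _ _ (by omega) (by omega), mul_zero]
        · rintro l ⟨h, h1, -, -⟩
          rcases l with _ | ⟨x, l⟩
          · simp at h1
          · obtain rfl : x = false := by simpa using h1
            rw [isBallotWith_cons_false] at h
            obtain ⟨v, hv, h⟩ := h
            omega
      · rw [← hN, numDown_succ _ _ _ _ (by omega)]
        have hd' : d ≤ u := by omega
        obtain rfl : N = u + d := by omega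
        push_cast
        rw [(ih u d k hd' rfl).2]
        have hs := Finset.sum_congr (s₁ := Finset.range i) rfl fun e _ =>
          congrArg ((numWords (i + e) (IsRiseEnding i e) : ℤ) * ·)
            (downCount_succ i e k u d (by omega))
        simp only [mul_add, Finset.sum_add_distrib] at hs
        rw [hs]
        congr 1
        by_cases h : k = 0
        · simp [h]
        · rw [if_neg h, (ih u d (k - 1) hd' rfl).1]
          refine Finset.sum_congr rfl fun e _ => ?_
          rw [if_neg (by exact_mod_cast h), Nat.cast_sub (by omega), Nat.cast_one]

/-! ### Words of step sequences -/

/-- The first `p` steps of the path with step sequence `w`, last step first. -/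
def revPath (w : ℕ → Bool) : ℕ → List Bool
  | 0 => []
  | p + 1 => w p :: revPath w p

lemma length_revPath (w : ℕ → Bool) (p : ℕ) : (revPath w p).length = p := by
  induction p with
  | zero => rfl
  | succ p ih => simp [revPath, ih]

lemma revPath_eq_iff {w w' : ℕ → Bool} {p : ℕ} :
    revPath w p = revPath w' p ↔ ∀ q < p, w q = w' q := by
  induction p with
  | zero => simp [revPath]
  | succ p ih =>
    simp only [revPath, List.cons.injEq, ih]
    constructor
    · rintro ⟨h1, h2⟩ q hq
      rcases Nat.lt_succ_iff_lt_or_eq.1 hq with h | rfl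
      · exact h2 q h
      · exact h1
    · exact fun h => ⟨h p (by omega), fun q hq => h q (by omega)⟩

lemma exists_revPath_eq (l : List Bool) : ∃ w, revPath w l.length = l := by
  induction l with
  | nil => exact ⟨fun _ => true, rfl⟩
  | cons x l ih =>
    obtain ⟨w, hw⟩ := ih
    refine ⟨fun q => if q < l.length then w q else x, ?_⟩
    simp only [List.length_cons, revPath, lt_irrefl, if_false, List.cons.injEq, true_and]
    refine (revPath_eq_iff.2 fun q hq => ?_).trans hw
    simp [hq]

/-- The number of rises among the first `p` steps. -/
def rises (w : ℕ → Bool) (p : ℕ) : ℕ := (revPath w p).count true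
/-- The number of falls among the first `p` steps. -/
def falls (w : ℕ → Bool) (p : ℕ) : ℕ := (revPath w p).count false

lemma rises_succ (w : ℕ → Bool) (p : ℕ) :
    rises w (p + 1) = rises w p + if w p = true then 1 else 0 := by
  simp [rises, revPath, List.count_cons]

lemma falls_succ (w : ℕ → Bool) (p : ℕ) :
    falls w (p + 1) = falls w p + if w p = false then 1 else 0 := by
  simp [falls, revPath, List.count_cons]

lemma rises_add_falls (w : ℕ → Bool) (p : ℕ) : rises w p + falls w p = p := by
  induction p with
  | zero => simp [rises, falls, revPath]
  | succ p ih =>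
    rw [rises_succ, falls_succ]
    cases w p <;> simp <;> omega

lemma rises_mono (w : ℕ → Bool) : Monotone (rises w) :=
  monotone_nat_of_le_succ fun p => by rw [rises_succ]; omega

lemma falls_eq_card (w : ℕ → Bool) (p : ℕ) :
    falls w p = ((Finset.range p).filter fun q => w q = false).card := by
  induction p with
  | zero => simp [falls, revPath]
  | succ p ih =>
    rw [falls_succ, Finset.range_add_one, Finset.filter_insert, ih]
    split_ifs
    · rw [Finset.card_insert_of_notMem (by simp)]
    · rfl

lemma isBallot_revPath {w : ℕ → Bool} {p : ℕ} :
    IsBallot (revPath w p) ↔ ∀ q ≤ p, falls w q ≤ rises w q := by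
  induction p with
  | zero => simp [IsBallot, revPath, falls, rises]
  | succ p ih =>
    rw [revPath, IsBallot, ih]
    constructor
    · rintro ⟨h1, h2⟩ q hq
      rcases Nat.le_succ_iff.1 hq with h | rfl
      · exact h1 q h
      · exact h2
    · exact fun h => ⟨fun q hq => h q (by omega), h (p + 1) le_rfl⟩

lemma head?_revPath_eq_some {w : ℕ → Bool} {p : ℕ} {x : Bool} :
    (revPath w p).head? = some x ↔ 1 ≤ p ∧ w (p - 1) = x := by
  cases p <;> simp [revPath]

lemma hasDoubleRise_revPath {i : ℕ} {w : ℕ → Bool} {p : ℕ} :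
    HasDoubleRise i (revPath w p) ↔
      ∃ q, q + 1 < p ∧ w q = true ∧ w (q + 1) = true ∧ rises w (q + 1) = i := by
  induction p with
  | zero => simp [HasDoubleRise, revPath]
  | succ p ih =>
    rw [revPath, HasDoubleRise, ih, head?_revPath_eq_some]
    constructor
    · rintro (⟨q, h1, h2⟩ | ⟨h1, ⟨h2, h3⟩, h4⟩)
      · exact ⟨q, by omega, h2⟩
      · obtain ⟨p, rfl⟩ : ∃ q, p = q + 1 := ⟨p - 1, by omega⟩
        exact ⟨p, by omega, h3, h1, h4⟩
    · rintro ⟨q, h1, h2, h3, h4⟩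
      rcases Nat.lt_succ_iff_lt_or_eq.1 h1 with h | rfl
      · exact .inl ⟨q, h, h2, h3, h4⟩
      · exact .inr ⟨h3, ⟨by omega, h2⟩, h4⟩

lemma latePeaks_revPath (i : ℕ) (w : ℕ → Bool) (p : ℕ) :
    latePeaks i (revPath w p) = ((Finset.range p).filter fun t =>
      w t = false ∧ (1 ≤ t ∧ w (t - 1) = true) ∧ i < rises w t).card := by
  induction p with
  | zero => simp [latePeaks, revPath]
  | succ p ih =>
    rw [revPath, latePeaks, ih, Finset.range_add_one, Finset.filter_insert]
    simp only [head?_revPath_eq_some]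
    change (_ + if w p = false ∧ (1 ≤ p ∧ w (p - 1) = true) ∧ i < rises w p then 1 else 0) = _
    by_cases h : w p = false ∧ (1 ≤ p ∧ w (p - 1) = true) ∧ i < rises w p
    · rw [if_pos h, if_pos h, Finset.card_insert_of_notMem (by simp)]
    · rw [if_neg h, if_neg h, add_zero]

/-- Read backwards, a path has its falls turned into rises. -/
lemma falls_add_rises_reverse (w : ℕ → Bool) (N j : ℕ) (hj : j ≤ N) :
    falls w (N - j) + rises (fun q => !w (N - 1 - q)) j = falls w N := by
  induction j with
  | zero => simp [rises, revPath]
  | succ j ih =>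
    rw [← ih (by omega), rises_succ, show N - j = N - (j + 1) + 1 by omega, falls_succ,
      show N - 1 - j = N - (j + 1) by omega]
    cases w (N - (j + 1))
    · simp
      omega
    · simp

open Equiv

/-! ### Permutations avoiding `123` and their boundary paths -/

/-- There are no `a < b < c` with `π a < π b < π c`. -/
def Avoids123 {n : ℕ} (π : Perm (Fin n)) : Prop :=
  ∀ a b c, a < b → b < c → π a < π b → ¬ π b < π c

lemma avoidsPattern_pattern123 {n : ℕ} {π : Perm (Fin n)} :
    AvoidsPattern π pattern123 ↔ Avoids123 π := by
  constructor
  · intro h a b c hab hbc h1 h2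
    apply h
    have hm : StrictMono ![a, b, c] := by
      rw [Fin.strictMono_iff_lt_succ]
      intro i
      fin_cases i <;> simpa
    have hm' : StrictMono fun i => π (![a, b, c] i) := by
      rw [Fin.strictMono_iff_lt_succ]
      intro i
      fin_cases i <;> simpa
    exact ⟨_, hm, fun i j => hm'.lt_iff_lt⟩
  · rintro h ⟨e, he, h'⟩
    exact h (e 0) (e 1) (e 2) (he (by decide)) (he (by decide)) ((h' 0 1).2 (by decide))
      ((h' 1 2).2 (by decide))

/-- The position `x` carries a left-to-right minimum of `π`. -/
def IsLRMin {n : ℕ} (π : Perm (Fin n)) (x : Fin n) : Prop := ∀ j < x, π x < π j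

lemma not_isLRMin {n : ℕ} {π : Perm (Fin n)} {x : Fin n} (h : ¬ IsLRMin π x) :
    ∃ j < x, π j < π x := by
  simp only [IsLRMin, not_forall, not_lt] at h
  obtain ⟨j, hj, h⟩ := h
  exact ⟨j, hj, lt_of_le_of_ne h (π.injective.ne hj.ne)⟩

/-- A cell is a left-to-right minimum of `π` if no cell lies weakly to the left and below it, a
condition that is symmetric under transposition. -/
lemma isLRMin_symm {n : ℕ} {π : Perm (Fin n)} {x : Fin n} :
    IsLRMin π.symm (π x) ↔ IsLRMin π x := by
  constructor
  · intro h j hj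
    by_contra hc
    have h1 := h (π j) (lt_of_le_of_ne (not_lt.1 hc) (π.injective.ne hj.ne))
    simp at h1
    exact absurd hj h1.not_gt
  · intro h y hy
    by_contra hc
    have h1 : π.symm y ≠ x := fun h => by simp [← h] at hy
    have h2 := h (π.symm y) (lt_of_le_of_ne (by simpa using hc) h1)
    simp at h2
    exact absurd hy h2.not_gt

lemma Avoids123.antitone_of_not_isLRMin {n : ℕ} {π : Perm (Fin n)} (h : Avoids123 π) {x y : Fin n}
    (hx : ¬ IsLRMin π x) (hxy : x < y) : π y < π x := by
  obtain ⟨j, hj, h1⟩ := not_isLRMin hx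
  have := h j x y hj hxy h1
  exact lt_of_le_of_ne (not_lt.1 this) (π.injective.ne hxy.ne')

lemma numFixedPoints_eq_two_iff {n : ℕ} {π : Perm (Fin n)} (h : Avoids123 π) :
    numFixedPoints π = 2 ↔
      ∃ b, (∃ a, IsLRMin π a ∧ π a = a) ∧ ¬ IsLRMin π b ∧ π b = b := by
  unfold numFixedPoints
  constructor
  · intro h2
    obtain ⟨x, y, hxy, hs⟩ := Finset.card_eq_two.1 h2
    wlog hlt : x < y generalizing x y
    · exact this y x hxy.symm (by rw [hs, Finset.pair_comm])
        (lt_of_le_of_ne (not_lt.1 hlt) hxy.symm)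
    have hx : π x = x := by
      have : x ∈ Finset.univ.filter fun i => π i = i := by simp [hs]
      simpa using this
    have hy : π y = y := by
      have : y ∈ Finset.univ.filter fun i => π i = i := by simp [hs]
      simpa using this
    refine ⟨y, ⟨x, ?_, hx⟩, fun hm => ?_, hy⟩
    · by_contra hm
      have := h.antitone_of_not_isLRMin hm hlt
      rw [hx, hy] at this
      exact absurd hlt this.not_gt
    · have := hm x hlt
      rw [hx, hy] at this
      exact absurd hlt this.not_gt
  · rintro ⟨b, ⟨a, ha, ha'⟩, hb, hb'⟩
    refine Finset.card_eq_two.2 ⟨a, b, fun h => hb (h ▸ ha), ?_⟩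
    ext z
    simp only [Finset.mem_filter, Finset.mem_univ, true_and, Finset.mem_insert,
      Finset.mem_singleton]
    constructor
    · intro hz
      by_cases hm : IsLRMin π z
      · left
        rcases lt_trichotomy z a with h1 | h1 | h1
        · have := ha z h1
          rw [hz, ha'] at this
          exact absurd h1 this.not_gt
        · exact h1
        · have := hm a h1
          rw [hz, ha'] at this
          exact absurd h1 this.not_gt
      · right
        rcases lt_trichotomy z b with h1 | h1 | h1
        · have := h.antitone_of_not_isLRMin hm h1
          rw [hz, hb'] at this
          exact absurd h1 this.not_gt
        · exact h1
        · have := h.antitone_of_not_isLRMin hb h1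
          rw [hz, hb'] at this
          exact absurd h1 this.not_gt
    · rintro (rfl | rfl) <;> assumption

lemma eq_of_both_fixed_not_isLRMin {n : ℕ} {π : Perm (Fin n)} (h : Avoids123 π) {b c : Fin n}
    (hb : ¬ IsLRMin π b) (hb' : π b = b) (hc : ¬ IsLRMin π c) (hc' : π c = c) : b = c := by
  rcases lt_trichotomy b c with h1 | h1 | h1
  · have := h.antitone_of_not_isLRMin hb h1
    rw [hb', hc'] at this
    exact absurd h1 this.not_gt
  · exact h1
  · have := h.antitone_of_not_isLRMin hc h1
    rw [hb', hc'] at this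
    exact absurd h1 this.not_gt

/-- The running minimum `min (π 0, …, π x)`, which encodes the boundary path of `π`. -/
def runMin {n : ℕ} (π : Perm (Fin n)) (x : Fin n) : Fin n :=
  (Finset.Iic x).inf' ⟨x, by simp⟩ π

lemma runMin_le {n : ℕ} (π : Perm (Fin n)) {j x : Fin n} (h : j ≤ x) : runMin π x ≤ π j :=
  Finset.inf'_le _ (by simpa using h)

lemma exists_eq_runMin {n : ℕ} (π : Perm (Fin n)) (x : Fin n) :
    ∃ j ≤ x, IsLRMin π j ∧ π j = runMin π x := by
  obtain ⟨j, hj, h⟩ := Finset.exists_mem_eq_inf' (s := Finset.Iic x) ⟨x, by simp⟩ π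
  rw [Finset.mem_Iic] at hj
  refine ⟨j, hj, fun k hk => ?_, h.symm⟩
  have := runMin_le π (hk.le.trans hj)
  exact lt_of_le_of_ne (h.symm.trans_le this) (π.injective.ne hk.ne')

lemma runMin_antitone {n : ℕ} (π : Perm (Fin n)) : Antitone (runMin π) := by
  intro x y hxy
  obtain ⟨j, hj, -, h⟩ := exists_eq_runMin π x
  rw [← h]
  exact runMin_le π (hj.trans hxy)

lemma IsLRMin.runMin_eq {n : ℕ} {π : Perm (Fin n)} {x : Fin n} (h : IsLRMin π x) :
    runMin π x = π x := by
  obtain ⟨j, hj, -, h'⟩ := exists_eq_runMin π x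
  rcases hj.eq_or_lt with rfl | hj
  · exact h'.symm
  · exact le_antisymm (runMin_le π le_rfl) (h'.symm ▸ (h j hj).le)

lemma IsLRMin.lt_runMin {n : ℕ} {π : Perm (Fin n)} {x y : Fin n} (h : IsLRMin π x) (hy : y < x) :
    π x < runMin π y := by
  obtain ⟨j, hj, -, h'⟩ := exists_eq_runMin π y
  rw [← h']
  exact h j (hj.trans_lt hy)

lemma isLRMin_iff_runMin {n : ℕ} {π : Perm (Fin n)} {x : Fin n} :
    IsLRMin π x ↔ ∀ j < x, runMin π x < runMin π j := by
  constructor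
  · intro h j hj
    rw [h.runMin_eq]
    exact h.lt_runMin hj
  · intro h
    obtain ⟨j, hj, hj', h'⟩ := exists_eq_runMin π x
    rcases hj.eq_or_lt with rfl | hj
    · exact hj'
    · have := h j hj
      rw [hj'.runMin_eq, h'] at this
      exact absurd this (lt_irrefl _)

/-- The boundary path is a Dyck path: the `x + 1` values at positions up to `x` are all at least
`runMin π x`. -/
lemma runMin_add_lt {n : ℕ} (π : Perm (Fin n)) (x : Fin n) : (runMin π x : ℕ) + x < n := by
  have h : (Finset.Iic x).image π ⊆ Finset.Ici (runMin π x) := by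
    intro y hy
    simp only [Finset.mem_image, Finset.mem_Iic, Finset.mem_Ici] at hy ⊢
    obtain ⟨j, hj, rfl⟩ := hy
    exact runMin_le π hj
  have := Finset.card_le_card h
  rw [Finset.card_image_of_injective _ π.injective, Fin.card_Iic, Fin.card_Ici] at this
  omega

/-- The index of the fall through column `x` on the path with heights `m`: it is preceded by the `n
- m x` rises through the rows `y ≥ m x` and by the falls through the `x` columns to the left. -/
def fallTime {n : ℕ} (m : Fin n → Fin n) (x : Fin n) : ℕ := n + x - m x

lemma fallTime_strictMono {n : ℕ} {m : Fin n → Fin n} (hm : Antitone m) :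
    StrictMono (fallTime m) := by
  intro x y h
  have h1 : (m y : ℕ) ≤ m x := hm h.le
  have h2 : (x : ℕ) < y := h
  have := (m x).2
  unfold fallTime
  omega

/-- The step sequence of the path with column heights `m`; only the steps `p < 2 * n` matter. -/
def stepWord {n : ℕ} (m : Fin n → Fin n) (p : ℕ) : Bool := decide (∀ x, fallTime m x ≠ p)

lemma stepWord_eq_true {n : ℕ} {m : Fin n → Fin n} {p : ℕ} :
    stepWord m p = true ↔ ∀ x, fallTime m x ≠ p := by simp [stepWord]

lemma stepWord_eq_false {n : ℕ} {m : Fin n → Fin n} {p : ℕ} :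
    stepWord m p = false ↔ ∃ x, fallTime m x = p := by simp [stepWord]

lemma stepWord_fallTime {n : ℕ} (m : Fin n → Fin n) (x : Fin n) :
    stepWord m (fallTime m x) = false := stepWord_eq_false.2 ⟨x, rfl⟩

lemma falls_stepWord {n : ℕ} {m : Fin n → Fin n} (hm : Antitone m) (p : ℕ) :
    falls (stepWord m) p = (Finset.univ.filter fun x => fallTime m x < p).card := by
  rw [falls_eq_card, ← Finset.card_image_of_injective _ (fallTime_strictMono hm).injective]
  congr 1
  ext q
  simp only [Finset.mem_filter, Finset.mem_range, Finset.mem_image, Finset.mem_univ, true_and,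
    stepWord_eq_false]
  constructor
  · rintro ⟨h, x, rfl⟩
    exact ⟨x, h, rfl⟩
  · rintro ⟨x, h, rfl⟩
    exact ⟨h, x, rfl⟩

lemma card_filter_lt_fin {n : ℕ} (b : Fin n) [DecidablePred fun j : Fin n => j < b] :
    (Finset.univ.filter fun j => j < b).card = b := by
  rw [← Fin.card_Iio b]
  congr 1
  ext
  simp

lemma card_filter_gt_fin {n : ℕ} (b : Fin n) [DecidablePred fun j : Fin n => b < j] :
    (Finset.univ.filter fun j => b < j).card = n - 1 - b := by
  rw [← Fin.card_Ioi b]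
  congr 1
  ext
  simp

lemma falls_fallTime {n : ℕ} {m : Fin n → Fin n} (hm : Antitone m) (x : Fin n) :
    falls (stepWord m) (fallTime m x) = x := by
  rw [falls_stepWord hm]
  simp only [(fallTime_strictMono hm).lt_iff_lt]
  exact card_filter_lt_fin x

lemma rises_fallTime {n : ℕ} {m : Fin n → Fin n} (hm : Antitone m) (x : Fin n) :
    rises (stepWord m) (fallTime m x) = n - m x := by
  have h1 := rises_add_falls (stepWord m) (fallTime m x)
  rw [falls_fallTime hm] at h1
  have := (m x).2
  unfold fallTime at *
  omega

lemma falls_stepWord_le {n : ℕ} {m : Fin n → Fin n} (hm : Antitone m)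
    (hd : ∀ x, (m x : ℕ) + x < n) (p : ℕ) : falls (stepWord m) p ≤ rises (stepWord m) p := by
  have h1 := rises_add_falls (stepWord m) p
  have h2 : falls (stepWord m) p ≤ p / 2 := by
    rw [falls_stepWord hm, ← Finset.card_range (p / 2), ← Finset.card_map Fin.valEmbedding]
    apply Finset.card_le_card
    intro q hq
    simp only [Finset.mem_map, Finset.mem_filter, Finset.mem_univ, true_and,
      Finset.mem_range] at hq ⊢
    obtain ⟨x, hx, rfl⟩ := hq
    have := hd x
    unfold fallTime at hx
    simp
    omega
  omega

/-- The boundary path of the inverse permutation is that of `π` reversed. It is enough that no fall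
of the one path is a fall of the other: since both have `n` falls among `2 * n` steps, they are then
complementary. -/
lemma stepWord_symm {n : ℕ} (π : Perm (Fin n)) {q : ℕ} (hq : q < 2 * n) :
    stepWord (runMin π.symm) q = !stepWord (runMin π) (2 * n - 1 - q) := by
  have key : ∀ x y, fallTime (runMin π) x + fallTime (runMin π.symm) y ≠ 2 * n - 1 := by
    intro x y
    have h1 := runMin_add_lt π x
    have h2 := runMin_add_lt π.symm y
    unfold fallTime
    rcases lt_or_ge x (runMin π.symm y) with h | h
    · have h3 : y < runMin π x := by
        obtain ⟨j, hj, -, h'⟩ := exists_eq_runMin π x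
        rw [← h']
        by_contra hc
        have := runMin_le π.symm (not_lt.1 hc)
        rw [symm_apply_apply] at this
        exact absurd (this.trans hj) h.not_ge
      rw [Fin.lt_def] at h h3
      omega
    · have h3 : runMin π x ≤ y := by
        obtain ⟨j, hj, -, h'⟩ := exists_eq_runMin π.symm y
        have := runMin_le π h
        rw [← h', apply_symm_apply] at this
        exact this.trans hj
      rw [Fin.le_def] at h h3
      omega
  have hlt : ∀ (σ : Perm (Fin n)) x, fallTime (runMin σ) x < 2 * n := by
    intro σ x
    unfold fallTime
    omega
  set S := Finset.univ.image (fallTime (runMin π))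
  set S' := Finset.univ.image fun y => 2 * n - 1 - fallTime (runMin π.symm) y
  have hS : S.card = n := by
    rw [Finset.card_image_of_injective _ (fallTime_strictMono (runMin_antitone π)).injective]
    simp
  have hS' : S'.card = n := by
    rw [Finset.card_image_of_injective]
    · simp
    · intro x y hxy
      apply (fallTime_strictMono (runMin_antitone π.symm)).injective
      have := hlt π.symm x
      have := hlt π.symm y
      simp only at hxy
      omega
  have hdis : Disjoint S S' := by
    rw [Finset.disjoint_left]
    intro p h1 h2
    simp only [S, S', Finset.mem_image, Finset.mem_univ, true_and] at h1 h2
    obtain ⟨x, rfl⟩ := h1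
    obtain ⟨y, h⟩ := h2
    have := hlt π.symm y
    exact key x y (by omega)
  have hun : S ∪ S' = Finset.range (2 * n) := by
    apply Finset.eq_of_subset_of_card_le
    · intro p
      simp only [S, S', Finset.mem_union, Finset.mem_image, Finset.mem_univ, true_and,
        Finset.mem_range]
      rintro (⟨x, rfl⟩ | ⟨y, rfl⟩)
      · exact hlt π x
      · omega
    · rw [Finset.card_union_of_disjoint hdis, hS, hS', Finset.card_range]
      omega
  by_cases h : stepWord (runMin π) (2 * n - 1 - q) = true
  · rw [h, Bool.not_true, stepWord_eq_false]
    have h1 : 2 * n - 1 - q ∈ S ∪ S' := by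
      rw [hun, Finset.mem_range]
      omega
    rw [stepWord_eq_true] at h
    rcases Finset.mem_union.1 h1 with h1 | h1
    · simp only [S, Finset.mem_image, Finset.mem_univ, true_and] at h1
      obtain ⟨x, hx⟩ := h1
      exact absurd hx (h x)
    · simp only [S', Finset.mem_image, Finset.mem_univ, true_and] at h1
      obtain ⟨y, hy⟩ := h1
      have := hlt π.symm y
      exact ⟨y, by omega⟩
  · rw [Bool.not_eq_true] at h
    rw [h, Bool.not_false, stepWord_eq_true]
    obtain ⟨x, hx⟩ := stepWord_eq_false.1 h
    intro y hy
    exact key x y (by omega)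

/-! ### Fixed points in terms of the boundary path -/

lemma fallTime_pos {n : ℕ} {m : Fin n → Fin n} (hd : ∀ x, (m x : ℕ) + x < n) (x : Fin n) :
    1 ≤ fallTime m x := by
  have := hd x
  unfold fallTime
  omega

/-- The peaks of the boundary path are the left-to-right minima. -/
lemma isLRMin_iff_stepWord {n : ℕ} {π : Perm (Fin n)} {x : Fin n} :
    IsLRMin π x ↔ stepWord (runMin π) (fallTime (runMin π) x - 1) = true := by
  have hx := runMin_add_lt π x
  rw [stepWord_eq_true]
  constructor
  · intro h y hy
    have hyx : y < x := by
      rw [← (fallTime_strictMono (runMin_antitone π)).lt_iff_lt]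
      have := fallTime_pos (runMin_add_lt π) x
      omega
    have h1 := h.lt_runMin hyx
    rw [← h.runMin_eq, Fin.lt_def] at h1
    have := runMin_add_lt π y
    rw [Fin.lt_def] at hyx
    unfold fallTime at hy
    omega
  · intro h
    by_contra hm
    obtain ⟨j, hj, hj', h'⟩ := exists_eq_runMin π x
    have hjx : j < x := lt_of_le_of_ne hj fun h => hm (h ▸ hj')
    have hx0 : (0 : ℕ) < x := lt_of_le_of_lt (Nat.zero_le _) (Fin.lt_def.1 hjx)
    let y : Fin n := ⟨x - 1, by omega⟩
    have hy : runMin π y = runMin π x := by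
      apply le_antisymm
      · rw [← h']
        apply runMin_le
        rw [Fin.le_def]
        rw [Fin.lt_def] at hjx
        simp only [y]
        omega
      · apply runMin_antitone
        rw [Fin.le_def]
        simp only [y]
        omega
    apply h y
    unfold fallTime
    rw [hy]
    simp only [y]
    omega

lemma fallTime_of_fixed {n : ℕ} {π : Perm (Fin n)} {a : Fin n} (ha : IsLRMin π a) (ha' : π a = a) :
    fallTime (runMin π) a = n := by
  unfold fallTime
  rw [ha.runMin_eq, ha']
  omega

/-- Left-to-right minima that are fixed points correspond to a peak in the middle of the path. -/
lemma exists_fixed_isLRMin_iff {n : ℕ} {π : Perm (Fin n)} (hn : 1 ≤ n) :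
    (∃ a, IsLRMin π a ∧ π a = a) ↔
      stepWord (runMin π) (n - 1) = true ∧ stepWord (runMin π) n = false := by
  constructor
  · rintro ⟨a, ha, ha'⟩
    have h := fallTime_of_fixed ha ha'
    rw [isLRMin_iff_stepWord, h] at ha
    exact ⟨ha, stepWord_eq_false.2 ⟨a, h⟩⟩
  · rintro ⟨h1, h2⟩
    obtain ⟨a, h⟩ := stepWord_eq_false.1 h2
    have ha : IsLRMin π a := by rwa [isLRMin_iff_stepWord, h]
    refine ⟨a, ha, ?_⟩
    have := runMin_add_lt π a
    unfold fallTime at h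
    rw [ha.runMin_eq] at h this
    rw [Fin.ext_iff]
    omega

/-- The `(n - b)`-th rise passes the row `b`. It is followed by a rise if and only if there is no
peak in that row, that is, if `b` is not the value of a left-to-right minimum; it comes in the first
half of the path, before the last rise of that half, if and only if `a < b`. -/
lemma hasDoubleRise_iff {n : ℕ} {π : Perm (Fin n)} {a b : Fin n} (ha : IsLRMin π a)
    (ha' : π a = a) :
    HasDoubleRise (n - b) (revPath (stepWord (runMin π)) n) ↔ a < b ∧ ¬ IsLRMin π.symm b := by
  have hs := fallTime_of_fixed ha ha'
  have hr := rises_fallTime (runMin_antitone π)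
  have hn : rises (stepWord (runMin π)) n = n - a := by
    rw [← congrArg (rises _) hs, hr, ha.runMin_eq, ha']
  rw [hasDoubleRise_revPath]
  set w := stepWord (runMin π) with hw
  constructor
  · rintro ⟨q, h1, h2, h3, h4⟩
    have h5 : rises w (q + 1 + 1) = n - b + 1 := by rw [rises_succ, h4, if_pos h3]
    constructor
    · have := rises_mono w (show q + 1 + 1 ≤ n by omega)
      rw [Fin.lt_def]
      omega
    · intro hb
      obtain ⟨x, rfl⟩ := π.surjective b
      rw [isLRMin_symm] at hb
      have h6 := hr x
      rw [hb.runMin_eq] at h6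
      have h7 : rises w (q + 1) = rises w q + 1 := by rw [rises_succ, if_pos h2]
      have h8 : fallTime (runMin π) x < q + 1 + 1 := (rises_mono w).reflect_lt (by omega)
      have h9 : q < fallTime (runMin π) x := (rises_mono w).reflect_lt (by omega)
      have h10 : fallTime (runMin π) x = q + 1 := by omega
      have := stepWord_fallTime (runMin π) x
      rw [h10, ← hw, h3] at this
      simp at this
  · rintro ⟨hab, hb⟩
    rw [Fin.lt_def] at hab
    -- the `(n - b)`-th rise is the step before the first time with `n - b` rises
    have hex : ∃ p, n - b ≤ rises w p := ⟨n, by omega⟩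
    have hp := Nat.find_spec hex
    have hmin := fun q => Nat.find_min (m := q) hex
    have hpn := Nat.find_min' hex (show n - b ≤ rises w n by omega)
    set p := Nat.find hex
    obtain ⟨q, hq⟩ : ∃ q, p = q + 1 := by
      refine ⟨p - 1, ?_⟩
      have : p ≠ 0 := by
        intro h
        rw [h] at hp
        have : rises w 0 = 0 := rfl
        omega
      omega
    have h1 := hmin q (by omega)
    rw [hq, rises_succ] at hp
    have h2 : w q = true := by
      by_contra h
      rw [if_neg h] at hp
      exact h1 hp
    have h3 : rises w (q + 1) = n - b := by
      rw [rises_succ, if_pos h2] at *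
      omega
    have hqn : q + 1 < n := by
      refine lt_of_le_of_ne (by omega) fun h => ?_
      rw [h] at h3
      omega
    refine ⟨q, hqn, h2, ?_, h3⟩
    by_contra hf
    rw [Bool.not_eq_true] at hf
    obtain ⟨x, hx⟩ := stepWord_eq_false.1 hf
    have h4 := hr x
    rw [hx, h3] at h4
    obtain ⟨j, -, hj, hj'⟩ := exists_eq_runMin π x
    have h5 : π j = b := by
      rw [hj', Fin.ext_iff]
      omega
    rw [← h5, isLRMin_symm] at hb
    exact hb hj

open Classical in
/-- The peaks in the first half of the path are the minima to the left of `a`. -/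
lemma latePeaks_eq {n : ℕ} {π : Perm (Fin n)} {a : Fin n} (b : Fin n) (ha : IsLRMin π a)
    (ha' : π a = a) :
    latePeaks (n - b) (revPath (stepWord (runMin π)) n) =
      (Finset.univ.filter fun x => IsLRMin π x ∧ x < a ∧ π x < b).card := by
  have hs := fallTime_of_fixed ha ha'
  have hmono := fallTime_strictMono (runMin_antitone π)
  rw [latePeaks_revPath, ← Finset.card_image_of_injective _ hmono.injective]
  congr 1
  ext t
  simp only [Finset.mem_filter, Finset.mem_range, Finset.mem_image, Finset.mem_univ, true_and]
  have key : ∀ x, IsLRMin π x →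
      (n - (b : ℕ) < rises (stepWord (runMin π)) (fallTime (runMin π) x) ↔ π x < b) := by
    intro x hx
    rw [rises_fallTime (runMin_antitone π), hx.runMin_eq, Fin.lt_def]
    omega
  constructor
  · rintro ⟨h1, h2, ⟨h3, h4⟩, h5⟩
    obtain ⟨x, rfl⟩ := stepWord_eq_false.1 h2
    have hx := isLRMin_iff_stepWord.2 h4
    refine ⟨x, ⟨hx, ?_, (key x hx).1 h5⟩, rfl⟩
    exact hmono.lt_iff_lt.1 (h1.trans_eq hs.symm)
  · rintro ⟨x, ⟨hx, h1, h2⟩, rfl⟩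
    refine ⟨?_, stepWord_fallTime _ _, ⟨fallTime_pos (runMin_add_lt π) x,
      isLRMin_iff_stepWord.1 hx⟩, (key x hx).2 h2⟩
    exact (hmono h1).trans_eq hs

open Classical in
/-- If `π` is decreasing on `P`, then it reverses ranks: `π x` has as many elements of the image of
`P` above it as `x` has elements of `P` to its left. -/
lemma card_rank_eq {n : ℕ} (π : Perm (Fin n)) (P : Fin n → Prop)
    (hP : ∀ x y, P x → P y → x < y → π y < π x) {x : Fin n} (hx : P x) :
    (Finset.univ.filter fun j => P j ∧ j < x).card =
      (Finset.univ.filter fun y => P (π.symm y) ∧ π x < y).card := by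
  apply Finset.card_equiv π
  intro j
  simp only [Finset.mem_filter, Finset.mem_univ, true_and, symm_apply_apply]
  refine and_congr_right fun hj => ⟨fun h => hP _ _ hj hx h, fun h => ?_⟩
  rcases lt_trichotomy j x with h1 | rfl | h1
  · exact h1
  · exact absurd h (lt_irrefl _)
  · exact absurd h (hP _ _ hx hj h1).not_gt

open Classical in
lemma eq_of_rank_eq {n : ℕ} (Q : Fin n → Prop) {y y' : Fin n} (hy : Q y) (hy' : Q y')
    (h : (Finset.univ.filter fun z => Q z ∧ y < z).card =
      (Finset.univ.filter fun z => Q z ∧ y' < z).card) : y = y' := by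
  wlog hlt : y < y' generalizing y y'
  · rcases (not_lt.1 hlt).eq_or_lt with h1 | h1
    · exact h1.symm
    · exact (this hy' hy h.symm h1).symm
  exfalso
  apply h.not_gt
  apply Finset.card_lt_card
  rw [Finset.ssubset_iff_of_subset]
  · exact ⟨y', by simp [hy', hlt], by simp⟩
  · intro z
    simp only [Finset.mem_filter, Finset.mem_univ, true_and]
    exact fun h => ⟨h.1, hlt.trans h.2⟩

lemma card_filter_and_add_card_filter_not_and {α : Type*} [Fintype α] (P Q : α → Prop)
    [DecidablePred fun x => P x ∧ Q x] [DecidablePred fun x => ¬ P x ∧ Q x] [DecidablePred Q] :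
    (Finset.univ.filter fun x => P x ∧ Q x).card + (Finset.univ.filter fun x => ¬ P x ∧ Q x).card =
      (Finset.univ.filter Q).card := by
  classical
  rw [← Finset.card_union_of_disjoint (Finset.disjoint_filter.2 fun x _ hx hx' => hx'.1 hx.1)]
  congr 1
  ext x
  simp only [Finset.mem_union, Finset.mem_filter, Finset.mem_univ, true_and]
  tauto

open Classical in
/-- An entry outside the minima is determined by equality of ranks in the remaining columns and
rows. Passing to complements turns this into a condition on the numbers of minima to the left of `b`
and above `b`. The former exceeds the latter by the number of minima in the square below and to the
left of `(b, b)`, which consists of `a` and of the minima on either side of `a`. -/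
lemma fixed_iff_card {n : ℕ} {π : Perm (Fin n)} (h : Avoids123 π) {a b : Fin n}
    (ha : IsLRMin π a) (ha' : π a = a) (hab : a < b) (hb : ¬ IsLRMin π b)
    (hb' : ¬ IsLRMin π.symm b) :
    π b = b ↔
      (Finset.univ.filter fun x => IsLRMin π x ∧ x < a ∧ π x < b).card +
        (Finset.univ.filter fun y => IsLRMin π.symm y ∧ y < a ∧ π.symm y < b).card +
          2 * (n - b) = n := by
  have hsymm : ∀ y, IsLRMin π (π.symm y) ↔ IsLRMin π.symm y := fun y => by
    rw [← isLRMin_symm, apply_symm_apply]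
  -- being fixed means having equal ranks
  have h1 : π b = b ↔ (Finset.univ.filter fun j => ¬ IsLRMin π j ∧ j < b).card =
      (Finset.univ.filter fun y => ¬ IsLRMin π.symm y ∧ b < y).card := by
    have hr := card_rank_eq π (fun x => ¬ IsLRMin π x)
      (fun x y hx _ hxy => h.antitone_of_not_isLRMin hx hxy) hb
    simp only [hsymm] at hr
    constructor
    · intro h
      rw [h] at hr
      convert hr
    · intro h
      refine eq_of_rank_eq (fun y => ¬ IsLRMin π.symm y) (isLRMin_symm.not.2 hb) hb' ?_
      have h' : (Finset.univ.filter fun y => ¬ IsLRMin π.symm y ∧ π b < y).card =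
        (Finset.univ.filter fun y => ¬ IsLRMin π.symm y ∧ b < y).card := by
        rw [← h]
        convert hr.symm
      convert h'
  have h2 : (Finset.univ.filter fun j => IsLRMin π j ∧ j < b).card +
      (Finset.univ.filter fun j => ¬ IsLRMin π j ∧ j < b).card = b := by
    rw [← card_filter_lt_fin b]
    exact card_filter_and_add_card_filter_not_and _ _
  have h3 : (Finset.univ.filter fun y => IsLRMin π.symm y ∧ b < y).card +
      (Finset.univ.filter fun y => ¬ IsLRMin π.symm y ∧ b < y).card = n - 1 - b := by
    rw [← card_filter_gt_fin b]
    exact card_filter_and_add_card_filter_not_and _ _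
  have h4 : (Finset.univ.filter fun y => IsLRMin π.symm y ∧ b < y).card =
      (Finset.univ.filter fun x => IsLRMin π x ∧ x < b ∧ b < π x).card := by
    symm
    apply Finset.card_equiv π
    intro x
    simp only [Finset.mem_filter, Finset.mem_univ, true_and, isLRMin_symm]
    refine and_congr_right fun hx => ⟨fun h => h.2, fun h => ⟨?_, h⟩⟩
    by_contra hc
    have := hx a (hab.trans_le (not_lt.1 hc))
    rw [ha'] at this
    exact absurd (hab.trans h) this.not_gt
  have h5 : (Finset.univ.filter fun y => IsLRMin π.symm y ∧ y < a ∧ π.symm y < b).card =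
      (Finset.univ.filter fun x => IsLRMin π x ∧ (a < x ∧ x < b)).card := by
    symm
    apply Finset.card_equiv π
    intro x
    simp only [Finset.mem_filter, Finset.mem_univ, true_and, isLRMin_symm, symm_apply_apply]
    refine and_congr_right fun hx => and_congr_left fun _ => ⟨fun h => ?_, fun h => ?_⟩
    · have := hx a h
      rwa [ha'] at this
    · by_contra hc
      rcases (not_lt.1 hc).eq_or_lt with rfl | hc
      · rw [ha'] at h
        exact absurd h (lt_irrefl _)
      · have := ha x hc
        rw [ha'] at this
        exact absurd h this.not_gt
  have h6 : (Finset.univ.filter fun j => IsLRMin π j ∧ j < b).card =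
      (Finset.univ.filter fun x => IsLRMin π x ∧ x < b ∧ b < π x).card +
      ((Finset.univ.filter fun x => IsLRMin π x ∧ x < a ∧ π x < b).card +
      ((Finset.univ.filter fun x => IsLRMin π x ∧ (a < x ∧ x < b)).card + 1)) := by
    have hne : ∀ x, IsLRMin π x → π x ≠ b := by
      rintro x hx rfl
      exact hb' (isLRMin_symm.2 hx)
    rw [← Finset.card_singleton a, ← Finset.card_union_of_disjoint,
      ← Finset.card_union_of_disjoint, ← Finset.card_union_of_disjoint]
    · congr 1
      ext x
      simp only [Finset.mem_filter, Finset.mem_univ, true_and, Finset.mem_union,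
        Finset.mem_singleton]
      constructor
      · rintro ⟨hx, hxb⟩
        rcases lt_or_gt_of_ne (hne x hx) with h7 | h7
        · rcases lt_trichotomy x a with h8 | h8 | h8
          · exact .inr (.inl ⟨hx, h8, h7⟩)
          · exact .inr (.inr (.inr h8))
          · exact .inr (.inr (.inl ⟨hx, h8, hxb⟩))
        · exact .inl ⟨hx, hxb, h7⟩
      · rintro (⟨hx, h7, -⟩ | ⟨hx, h7, -⟩ | ⟨hx, -, h7⟩ | rfl)
        · exact ⟨hx, h7⟩
        · exact ⟨hx, h7.trans hab⟩
        · exact ⟨hx, h7⟩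
        · exact ⟨ha, hab⟩
    · rw [Finset.disjoint_left]
      intro x
      simp only [Finset.mem_filter, Finset.mem_univ, true_and, Finset.mem_union,
        Finset.mem_singleton]
      rintro ⟨hx, h7, h8⟩ (⟨-, h9, h10⟩ | ⟨-, h9, h10⟩ | rfl)
      · exact absurd h8 h10.not_gt
      · have := hx a h9
        rw [ha'] at this
        exact absurd (hab.trans h8) this.not_gt
      · rw [ha'] at h8
        exact absurd h8 hab.not_gt
    · rw [Finset.disjoint_left]
      intro x
      simp only [Finset.mem_filter, Finset.mem_univ, true_and, Finset.mem_union,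
        Finset.mem_singleton]
      rintro ⟨hx, h7, h8⟩ (⟨-, h9, h10⟩ | rfl)
      · exact absurd h7 h9.not_gt
      · exact absurd h7 (lt_irrefl _)
    · simp
  rw [h1]
  omega

/-- The condition that `b` is a fixed point but not a left-to-right minimum, in terms of the two
halves of the boundary path, for a permutation with a fixed left-to-right minimum. -/
lemma fixed_iff_words {n : ℕ} {π : Perm (Fin n)} (h : Avoids123 π) {a : Fin n} (b : Fin n)
    (ha : IsLRMin π a) (ha' : π a = a) :
    (¬ IsLRMin π b ∧ π b = b) ↔
      HasDoubleRise (n - b) (revPath (stepWord (runMin π)) n) ∧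
      HasDoubleRise (n - b) (revPath (stepWord (runMin π.symm)) n) ∧
      latePeaks (n - b) (revPath (stepWord (runMin π)) n) +
        latePeaks (n - b) (revPath (stepWord (runMin π.symm)) n) + 2 * (n - b) = n := by
  have hs' : π.symm a = a := by rw [symm_apply_eq, ha']
  have hs : IsLRMin π.symm a := by
    rw [← ha', isLRMin_symm]
    exact ha
  rw [hasDoubleRise_iff ha ha', hasDoubleRise_iff hs hs', latePeaks_eq b ha ha',
    latePeaks_eq b hs hs', symm_symm]
  constructor
  · rintro ⟨hb, hb'⟩
    have hab : a < b := by
      rcases lt_trichotomy a b with h1 | rfl | h1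
      · exact h1
      · exact absurd ha hb
      · have := h.antitone_of_not_isLRMin hb h1
        rw [ha', hb'] at this
        exact absurd h1 this.not_gt
    have hc : ¬ IsLRMin π.symm b := by rwa [← hb', isLRMin_symm]
    exact ⟨⟨hab, hc⟩, ⟨hab, hb⟩, (fixed_iff_card h ha ha' hab hb hc).1 hb'⟩
  · rintro ⟨⟨hab, hc⟩, ⟨-, hb⟩, hcard⟩
    exact ⟨hb, (fixed_iff_card h ha ha' hab hb hc).2 hcard⟩

/-! ### The bijection with Dyck paths -/

lemma fallTime_injective {n : ℕ} : Function.Injective (fallTime (n := n)) := by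
  intro m m' h
  ext x
  have h1 := congrFun h x
  have := (m x).2
  have := (m' x).2
  unfold fallTime at h1
  omega

lemma fallTime_lt {n : ℕ} (m : Fin n → Fin n) (x : Fin n) : fallTime m x < 2 * n := by
  unfold fallTime
  omega

lemma eq_of_stepWord_eq {n : ℕ} {m m' : Fin n → Fin n} (hm : Antitone m) (hm' : Antitone m')
    (h : ∀ p < 2 * n, stepWord m p = stepWord m' p) : m = m' := by
  apply fallTime_injective
  apply ((fallTime_strictMono hm).range_inj (fallTime_strictMono hm')).1
  ext p
  rcases lt_or_ge p (2 * n) with hp | hp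
  · have := h p hp
    simp only [Set.mem_range, ← stepWord_eq_false, this]
  · simp only [Set.mem_range]
    constructor
    · rintro ⟨x, rfl⟩
      exact absurd (fallTime_lt m x) hp.not_gt
    · rintro ⟨x, rfl⟩
      exact absurd (fallTime_lt m' x) hp.not_gt

/-- A `123`-avoiding permutation is determined by its boundary path, since off the minima it is the
decreasing bijection between the remaining columns and the remaining rows. -/
lemma Avoids123.eq_of_runMin_eq {n : ℕ} {π σ : Perm (Fin n)} (hπ : Avoids123 π) (hσ : Avoids123 σ)
    (h : runMin π = runMin σ) : π = σ := by
  classical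
  have hA : ∀ x, IsLRMin π x ↔ IsLRMin σ x := fun x => by
    rw [isLRMin_iff_runMin, isLRMin_iff_runMin, h]
  have hB : ∀ y, IsLRMin π.symm y ↔ IsLRMin σ.symm y := by
    have key : ∀ {π σ : Perm (Fin n)}, runMin π = runMin σ → (∀ x, IsLRMin π x ↔ IsLRMin σ x) →
        ∀ y, IsLRMin π.symm y → IsLRMin σ.symm y := by
      intro π σ h hA y hy
      obtain ⟨x, rfl⟩ := π.surjective y
      rw [isLRMin_symm] at hy
      rw [← hy.runMin_eq, h, ((hA x).1 hy).runMin_eq, isLRMin_symm]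
      exact (hA x).1 hy
    exact fun y => ⟨key h hA y, key h.symm (fun x => (hA x).symm) y⟩
  ext1 x
  by_cases hx : IsLRMin π x
  · rw [← hx.runMin_eq, h, ((hA x).1 hx).runMin_eq]
  · have hx' := (hA x).not.1 hx
    have h1 := card_rank_eq π (fun x => ¬ IsLRMin π x)
      (fun x y hx _ hxy => hπ.antitone_of_not_isLRMin hx hxy) hx
    have h2 := card_rank_eq σ (fun x => ¬ IsLRMin σ x)
      (fun x y hx _ hxy => hσ.antitone_of_not_isLRMin hx hxy) hx'
    have hsymm : ∀ (τ : Perm (Fin n)) y, IsLRMin τ (τ.symm y) ↔ IsLRMin τ.symm y := fun τ y => by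
      rw [← isLRMin_symm, apply_symm_apply]
    simp only [hsymm, hA, hB] at h1 h2
    refine eq_of_rank_eq (fun y => ¬ IsLRMin σ.symm y) ?_ (isLRMin_symm.not.2 hx') ?_
    · rw [← hB]
      exact isLRMin_symm.not.2 hx
    · have h3 := h1.symm.trans (Eq.trans (by congr!) h2)
      convert h3

/-- Every Dyck path is the boundary path of a `123`-avoiding permutation: put the entries of the
peaks at the peaks, and fill the other rows and columns in decreasing order. -/
lemma exists_avoids123_of_antitone {n : ℕ} (m : Fin n → Fin n) (hm : Antitone m)
    (hd : ∀ x, (m x : ℕ) + x < n) : ∃ π : Perm (Fin n), Avoids123 π ∧ runMin π = m := by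
  classical
  -- `A` and `B` are the columns and the rows of the peaks of the given path
  let A : Fin n → Prop := fun x => ∀ j < x, m x < m j
  let B : Fin n → Prop := fun y => ∃ x, A x ∧ m x = y
  have hA : ∀ x y, A x → A y → x < y → m y < m x := fun x y _ hy h => hy x h
  have hfirst : ∀ x, ∃ j ≤ x, A j ∧ m j = m x := by
    intro x
    obtain ⟨j, hj, hmin⟩ :=
      WellFounded.has_min (wellFounded_lt (α := Fin n)) {j | m j = m x} ⟨x, rfl⟩
    refine ⟨j, not_lt.1 (hmin x rfl), fun k hk => ?_, hj⟩
    refine lt_of_le_of_ne (hm hk.le) fun h => hmin k ?_ hk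
    exact h.symm.trans hj
  have hinj : ∀ x y, A x → A y → m x = m y → x = y := by
    intro x y hx hy h
    rcases lt_trichotomy x y with h1 | h1 | h1
    · exact absurd h (hA x y hx hy h1).ne'
    · exact h1
    · exact absurd h (hA y x hy hx h1).ne
  let e₁ : {x // A x} ≃ {y // B y} :=
    Equiv.ofBijective (fun x => ⟨m x, x, x.2, rfl⟩) (by
      constructor
      · rintro ⟨x, hx⟩ ⟨y, hy⟩ h
        simp only [Subtype.mk.injEq] at h
        exact Subtype.ext (hinj x y hx hy h)
      · rintro ⟨_, x, hx, rfl⟩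
        exact ⟨⟨x, hx⟩, rfl⟩)
  have hcard : Fintype.card {x // ¬ A x} = Fintype.card {y // ¬ B y} :=
    Fintype.card_compl_eq_card_compl A B (Fintype.card_congr e₁)
  let f₁ := Fintype.orderIsoFinOfCardEq {x // ¬ A x} rfl
  let f₂ := Fintype.orderIsoFinOfCardEq {y // ¬ B y} hcard.symm
  let e₂ : {x // ¬ A x} ≃ {y // ¬ B y} := f₁.symm.toEquiv.trans (Fin.revPerm.trans f₂.toEquiv)
  have he₂ : ∀ x y, x < y → e₂ y < e₂ x := by
    intro x y h
    change f₂ (Fin.rev (f₁.symm y)) < f₂ (Fin.rev (f₁.symm x))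
    rw [f₂.lt_iff_lt, Fin.rev_lt_rev, f₁.symm.lt_iff_lt]
    exact h
  let π : Perm (Fin n) := Equiv.subtypeCongr e₁ e₂
  have hπ₁ : ∀ x, A x → π x = m x := by
    intro x hx
    simp [π, Equiv.subtypeCongr, Equiv.sumCompl_symm_apply_of_pos hx]
    rfl
  have hπ₂ : ∀ x (hx : ¬ A x), π x = e₂ ⟨x, hx⟩ := by
    intro x hx
    simp [π, Equiv.subtypeCongr, Equiv.sumCompl_symm_apply_of_neg hx]
  have hanti : ∀ x y, ¬ A x → ¬ A y → x < y → π y < π x := by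
    intro x y hx hy h
    rw [hπ₂ x hx, hπ₂ y hy]
    exact he₂ _ _ h
  have hAB : ∀ x, A x ↔ B (π x) := by
    intro x
    constructor
    · intro hx
      exact ⟨x, hx, (hπ₁ x hx).symm⟩
    · intro hB
      by_contra hx
      rw [hπ₂ x hx] at hB
      exact (e₂ ⟨x, hx⟩).2 hB
  have hmB : ∀ x, B (m x) := by
    intro x
    obtain ⟨j, -, hj, hj'⟩ := hfirst x
    exact ⟨j, hj, hj'⟩
  -- Suppose that an entry off the peaks lies below the path. The `n - m x > x` rows from `m x`
  -- upwards hold at most as many peaks as there are peaks to the left of `x`, so more rows than columns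
  -- remain, and the rank of `π x` is too large.
  have habove : ∀ x, m x ≤ π x := by
    intro x
    by_cases hx : A x
    · exact (hπ₁ x hx).ge
    by_contra hlt
    rw [not_le] at hlt
    have h1 := card_rank_eq π (fun x => ¬ A x) hanti hx
    simp only [hAB, apply_symm_apply] at h1
    have h2 := card_filter_and_add_card_filter_not_and A (· < x)
    rw [card_filter_lt_fin] at h2
    have h3 := card_filter_and_add_card_filter_not_and B (m x ≤ ·)
    have h4 : (Finset.univ.filter fun y => m x ≤ y).card = n - m x := by
      rw [← Fin.card_Ici]
      congr 1
      ext
      simp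
    have h5 : (Finset.univ.filter fun y => B y ∧ m x ≤ y).card ≤
        (Finset.univ.filter fun j => A j ∧ j < x).card := by
      refine (Finset.card_le_card ?_).trans
        (Finset.card_image_le (s := Finset.univ.filter fun j => A j ∧ j < x) (f := m))
      intro y hy
      simp only [Finset.mem_filter, Finset.mem_univ, true_and, Finset.mem_image] at hy ⊢
      obtain ⟨⟨j, hj, rfl⟩, h⟩ := hy
      refine ⟨j, ⟨hj, ?_⟩, rfl⟩
      rcases lt_trichotomy j x with h6 | rfl | h6
      · exact h6
      · exact absurd hj hx
      · exact absurd h (hj x h6).not_ge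
    have h6 : (Finset.univ.filter fun y => ¬ B y ∧ m x ≤ y).card ≤
        (Finset.univ.filter fun y => ¬ B y ∧ π x < y).card := by
      apply Finset.card_le_card
      intro y
      simp only [Finset.mem_filter, Finset.mem_univ, true_and]
      exact fun h => ⟨h.1, hlt.trans_le h.2⟩
    have h7 : (Finset.univ.filter fun j => ¬ A j ∧ j < x).card =
        (Finset.univ.filter fun y => ¬ B y ∧ π x < y).card := by
      rw [← h1]
      simp only [hAB]
    have := hd x
    omega
  refine ⟨π, ?_, ?_⟩
  · intro a b c hab hbc h1 h2
    by_cases hb : A b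
    · by_cases ha : A a
      · have := hA a b ha hb hab
        rw [← hπ₁ a ha, ← hπ₁ b hb] at this
        exact absurd h1 this.not_gt
      · by_cases hc : A c
        · have := hA b c hb hc hbc
          rw [← hπ₁ b hb, ← hπ₁ c hc] at this
          exact absurd h2 this.not_gt
        · exact absurd (h1.trans h2) (hanti a c ha hc (hab.trans hbc)).not_gt
    · by_cases ha : A a
      · by_cases hc : A c
        · have := hA a c ha hc (hab.trans hbc)
          rw [← hπ₁ a ha, ← hπ₁ c hc] at this
          exact absurd (h1.trans h2) this.not_gt
        · exact absurd h2 (hanti b c hb hc hbc).not_gt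
      · exact absurd h1 (hanti a b ha hb hab).not_gt
  · ext1 x
    apply le_antisymm
    · obtain ⟨j, hj, hj', h⟩ := hfirst x
      rw [← h, ← hπ₁ j hj']
      exact runMin_le π hj
    · obtain ⟨j, hj, -, h⟩ := exists_eq_runMin π x
      rw [← h]
      exact (hm hj).trans (habove j)

/-- Every Dyck word of length `2 * n` is the step sequence of a path given by column heights: if `s
x` is the index of the fall through column `x`, then the height is `n + x - s x`. -/
lemma exists_stepWord_eq {n : ℕ} (w : ℕ → Bool) (hn : falls w (2 * n) = n)
    (hw : ∀ p ≤ 2 * n, falls w p ≤ rises w p) :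
    ∃ m : Fin n → Fin n, Antitone m ∧ (∀ x, (m x : ℕ) + x < n) ∧
      ∀ p < 2 * n, stepWord m p = w p := by
  set S := (Finset.range (2 * n)).filter fun q => w q = false with hS
  have hcard : S.card = n := by rw [hS, ← falls_eq_card, hn]
  let s := S.orderEmbOfFin hcard
  have hsS : ∀ x, s x ∈ S := fun x => S.orderEmbOfFin_mem hcard x
  have hs2 : ∀ x, s x < 2 * n ∧ w (s x) = false := fun x => by
    have := hsS x
    rw [hS] at this
    simpa using this
  have hfalls : ∀ x, falls w (s x) = x := by
    intro x
    rw [falls_eq_card, ← Fin.card_Iio x, ← Finset.card_image_of_injective _ s.injective]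
    congr 1
    ext q
    simp only [Finset.mem_filter, Finset.mem_range, Finset.mem_image, Finset.mem_Iio]
    constructor
    · rintro ⟨h1, h2⟩
      have hq : q ∈ S := by
        rw [hS]
        simp only [Finset.mem_filter, Finset.mem_range]
        exact ⟨h1.trans (hs2 x).1, h2⟩
      have hr : q ∈ Set.range s := by
        rw [Finset.range_orderEmbOfFin]
        exact hq
      obtain ⟨y, rfl⟩ := hr
      exact ⟨y, s.lt_iff_lt.1 h1, rfl⟩
    · rintro ⟨y, hy, rfl⟩
      exact ⟨s.lt_iff_lt.2 hy, (hs2 y).2⟩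
  -- the ballot condition just after the fall through `x`
  have hlow : ∀ x : Fin n, 2 * (x : ℕ) + 1 ≤ s x := by
    intro x
    have h1 := hw (s x + 1) (hs2 x).1
    have h2 := rises_add_falls w (s x + 1)
    rw [falls_succ, if_pos (hs2 x).2, hfalls] at h1 h2
    omega
  -- there are at most `n` rises before the fall through `x`, so `n + x - s x` does not truncate
  have hup : ∀ x : Fin n, s x ≤ n + x := by
    intro x
    have h1 := rises_add_falls w (s x)
    have h2 := rises_add_falls w (2 * n)
    have h3 := rises_mono w (hs2 x).1.le
    rw [hfalls] at h1
    omega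
  have hlt : ∀ x : Fin n, n + x - s x < n := fun x => by
    have := hlow x
    omega
  let m : Fin n → Fin n := fun x => ⟨n + x - s x, hlt x⟩
  have hft : ∀ x, fallTime m x = s x := by
    intro x
    have := hup x
    simp only [fallTime, m]
    omega
  refine ⟨m, ?_, ?_, ?_⟩
  · intro x y hxy
    have h1 : falls w (s x) ≤ falls w (s y) := by
      rw [hfalls, hfalls]
      exact hxy
    have h2 := rises_mono w (s.monotone hxy)
    have h3 := rises_add_falls w (s x)
    have h4 := rises_add_falls w (s y)
    have h5 := hup x
    have h6 := hup y
    rw [Fin.le_def] at *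
    rw [hfalls] at h3 h4
    simp only [m]
    omega
  · intro x
    have := hlow x
    simp only [m]
    omega
  · intro p hp
    cases h : w p
    · rw [stepWord_eq_false]
      have hr : p ∈ Set.range s := by
        rw [Finset.range_orderEmbOfFin, hS]
        simp [hp, h]
      obtain ⟨x, rfl⟩ := hr
      exact ⟨x, hft x⟩
    · rw [stepWord_eq_true]
      intro x hx
      rw [hft] at hx
      have := (hs2 x).2
      rw [hx, h] at this
      simp at this

/-! ### Pairs of half paths -/

/-- The two halves of the boundary path of a `123`-avoiding permutation that has a fixed
left-to-right minimum and the fixed point `n - i` which is not a left-to-right minimum. -/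
def IsHalfPair (n i : ℕ) (x : List Bool × List Bool) : Prop :=
  (IsBallot x.1 ∧ IsBallot x.2) ∧ x.1.count true = x.2.count true ∧
    (x.1.head? = some true ∧ x.2.head? = some true) ∧
      HasDoubleRise i x.1 ∧ HasDoubleRise i x.2 ∧ latePeaks i x.1 + latePeaks i x.2 + 2 * i = n

open Classical in
/-- The bijection sending `π` to the halves of its boundary path; the second one is read off from
`π⁻¹`. -/
lemma card_filter_eq_card_isHalfPair {n : ℕ} (b : Fin n) :
    (Finset.univ.filter fun π : Perm (Fin n) => Avoids123 π ∧
      (∃ a, IsLRMin π a ∧ π a = a) ∧ ¬ IsLRMin π b ∧ π b = b).card =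
    ((boolWords n ×ˢ boolWords n).filter (IsHalfPair n (n - b))).card := by
  have hn : 1 ≤ n := b.pos
  have hmid : ∀ π : Perm (Fin n),
      stepWord (runMin π.symm) (n - 1) = !stepWord (runMin π) n := fun π => by
    rw [stepWord_symm π (by omega), show 2 * n - 1 - (n - 1) = n by omega]
  apply Finset.card_bij fun π _ =>
    (revPath (stepWord (runMin π)) n, revPath (stepWord (runMin π.symm)) n)
  · intro π hπ
    simp only [Finset.mem_filter, Finset.mem_univ, true_and] at hπ
    obtain ⟨h, ⟨a, ha, ha'⟩, hb⟩ := hπ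
    have hs' : π.symm a = a := by rw [symm_apply_eq, ha']
    have hs : IsLRMin π.symm a := by
      rw [← ha', isLRMin_symm]
      exact ha
    have hrise : ∀ σ : Perm (Fin n), IsLRMin σ a → σ a = a →
        rises (stepWord (runMin σ)) n = n - a := fun σ hσ hσ' => by
      rw [← congrArg (rises _) (fallTime_of_fixed hσ hσ'), rises_fallTime (runMin_antitone σ),
        hσ.runMin_eq, hσ']
    have hend := (exists_fixed_isLRMin_iff hn).1 ⟨a, ha, ha'⟩
    simp only [Finset.mem_filter, Finset.mem_product, mem_boolWords, length_revPath, and_self,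
      true_and]
    refine ⟨⟨?_, ?_⟩, ?_, ⟨?_, ?_⟩, (fixed_iff_words h b ha ha').1 hb⟩
    · exact isBallot_revPath.2 fun q _ => falls_stepWord_le (runMin_antitone π) (runMin_add_lt π) q
    · exact isBallot_revPath.2 fun q _ =>
        falls_stepWord_le (runMin_antitone π.symm) (runMin_add_lt π.symm) q
    · exact (hrise π ha ha').trans (hrise π.symm hs hs').symm
    · exact head?_revPath_eq_some.2 ⟨hn, hend.1⟩
    · exact head?_revPath_eq_some.2 ⟨hn, by rw [hmid, hend.2]; rfl⟩
  · intro π hπ σ hσ h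
    simp only [Finset.mem_filter, Finset.mem_univ, true_and] at hπ hσ
    simp only [Prod.mk.injEq, revPath_eq_iff] at h
    apply hπ.1.eq_of_runMin_eq hσ.1
    apply eq_of_stepWord_eq (runMin_antitone π) (runMin_antitone σ)
    intro p hp
    rcases lt_or_ge p n with hpn | hpn
    · exact h.1 p hpn
    · have h1 := h.2 (2 * n - 1 - p) (by omega)
      rw [stepWord_symm π (by omega), stepWord_symm σ (by omega),
        show 2 * n - 1 - (2 * n - 1 - p) = p by omega] at h1
      exact Bool.not_inj h1
  · rintro ⟨L, R⟩ hx
    simp only [Finset.mem_filter, Finset.mem_product, mem_boolWords] at hx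
    obtain ⟨⟨hL, hR⟩, ⟨hbL, hbR⟩, hc, ⟨heL, heR⟩, hw⟩ := hx
    dsimp only at hbL hbR hc heL heR hw
    obtain ⟨w₁, h₁⟩ := exists_revPath_eq L
    obtain ⟨w₂, h₂⟩ := exists_revPath_eq R
    rw [hL] at h₁
    rw [hR] at h₂
    -- glue the two halves to a Dyck word of length `2 * n`
    let w : ℕ → Bool := fun p => if p < n then w₁ p else !w₂ (2 * n - 1 - p)
    have hwL : revPath w n = L := by
      rw [← h₁, revPath_eq_iff]
      intro q hq
      simp [w, hq]
    have hwR : revPath (fun q => !w (2 * n - 1 - q)) n = R := by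
      rw [← h₂, revPath_eq_iff]
      intro q hq
      have h3 : ¬ 2 * n - 1 - q < n := by omega
      simp only [w, h3, if_false, Bool.not_not]
      rw [show 2 * n - 1 - (2 * n - 1 - q) = q by omega]
    have hrev := falls_add_rises_reverse w (2 * n)
    have hfn : falls w (2 * n) = n := by
      have h3 := hrev n (by omega)
      have h4 := rises_add_falls w n
      have h5 : rises w n = rises (fun q => !w (2 * n - 1 - q)) n := by
        rw [rises, rises, hwL, hwR, hc]
      rw [show 2 * n - n = n by omega] at h3
      omega
    rw [← hwL, isBallot_revPath] at hbL
    rw [← hwR, isBallot_revPath] at hbR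
    obtain ⟨m, hm, hd, hstep⟩ := exists_stepWord_eq w hfn (by
      intro p hp
      rcases le_or_gt p n with hpn | hpn
      · exact hbL p hpn
      · have h3 := hrev (2 * n - p) (by omega)
        have h4 := hbR (2 * n - p) (by omega)
        have h5 := rises_add_falls (fun q => !w (2 * n - 1 - q)) (2 * n - p)
        have h6 := rises_add_falls w p
        rw [show 2 * n - (2 * n - p) = p by omega] at h3
        omega)
    obtain ⟨π, hπ, rfl⟩ := exists_avoids123_of_antitone m hm hd
    have hπL : revPath (stepWord (runMin π)) n = L := by
      rw [← hwL, revPath_eq_iff]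
      exact fun q hq => hstep q (by omega)
    have hπR : revPath (stepWord (runMin π.symm)) n = R := by
      rw [← hwR, revPath_eq_iff]
      intro q hq
      rw [stepWord_symm π (by omega), hstep _ (by omega)]
    refine ⟨π, ?_, by rw [hπL, hπR]⟩
    rw [← hπL, head?_revPath_eq_some] at heL
    rw [← hπR, head?_revPath_eq_some, hmid] at heR
    obtain ⟨a, ha, ha'⟩ := (exists_fixed_isLRMin_iff hn).2 ⟨heL.2, by simpa using heR.2⟩
    simp only [Finset.mem_filter, Finset.mem_univ, true_and]
    refine ⟨hπ, ⟨a, ha, ha'⟩, (fixed_iff_words hπ b ha ha').2 ?_⟩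
    rw [hπL, hπR]
    exact hw

open Classical in
/-- The number of pairs satisfying `IsHalfPair n i`. -/
noncomputable def numHalfPairs (n i : ℕ) : ℕ :=
  ((boolWords n ×ˢ boolWords n).filter (IsHalfPair n i)).card

lemma avoidersWithFixedPoints_eq_sum (n : ℕ) :
    avoidersWithFixedPoints n 2 pattern123 = ∑ b : Fin n, numHalfPairs n (n - b) := by
  classical
  have h : {π : Perm (Fin n) | AvoidsPattern π pattern123 ∧ numFixedPoints π = 2} =
      ((Finset.univ.biUnion fun b : Fin n => Finset.univ.filter fun π : Perm (Fin n) =>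
        Avoids123 π ∧ (∃ a, IsLRMin π a ∧ π a = a) ∧ ¬ IsLRMin π b ∧ π b = b : Finset _) :
          Set (Perm (Fin n))) := by
    ext π
    simp only [avoidsPattern_pattern123, Set.mem_ofPred_eq, Finset.coe_biUnion, Finset.mem_univ,
      Set.iUnion_true, Set.mem_iUnion, Finset.coe_filter, Finset.mem_coe, true_and]
    constructor
    · rintro ⟨h1, h2⟩
      obtain ⟨b, hb⟩ := (numFixedPoints_eq_two_iff h1).1 h2
      exact ⟨b, h1, hb⟩
    · rintro ⟨b, h1, hb⟩
      exact ⟨h1, (numFixedPoints_eq_two_iff h1).2 ⟨b, hb⟩⟩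
  rw [avoidersWithFixedPoints, h, Set.ncard_coe_finset, Finset.card_biUnion]
  · refine Finset.sum_congr rfl fun b _ => ?_
    rw [numHalfPairs, ← card_filter_eq_card_isHalfPair b]
  · intro b _ c _ hbc
    rw [Function.onFun, Finset.disjoint_left]
    intro π hb hc
    simp only [Finset.mem_filter, Finset.mem_univ, true_and] at hb hc
    exact hbc (eq_of_both_fixed_not_isLRMin hb.1 hb.2.2.1 hb.2.2.2 hc.2.2.1 hc.2.2.2)

lemma numHalfPairs_eq_zero {n i : ℕ} (h : n < 2 * i) : numHalfPairs n i = 0 := by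
  classical
  rw [numHalfPairs, Finset.card_eq_zero, Finset.filter_eq_empty_iff]
  rintro x - ⟨-, -, -, -, -, hx⟩
  omega

/-! ### Evaluation of the sum -/

/-- Sort the pairs by the number `u` of rises in each half and the number `k` of late peaks in the
first half. -/
lemma numHalfPairs_eq_sum {n i : ℕ} (h : 2 * i ≤ n) :
    numHalfPairs n i = ∑ u ∈ Finset.range (n + 1), ∑ k ∈ Finset.range (n - 2 * i + 1),
      numWords n (IsUpWord i k u (n - u)) * numWords n (IsUpWord i (n - 2 * i - k) u (n - u)) := by
  classical
  have hu : (boolWords n ×ˢ boolWords n).filter (IsHalfPair n i) =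
      (Finset.range (n + 1) ×ˢ Finset.range (n - 2 * i + 1)).biUnion fun y =>
        ((boolWords n).filter (IsUpWord i y.2 y.1 (n - y.1))) ×ˢ
          ((boolWords n).filter (IsUpWord i (n - 2 * i - y.2) y.1 (n - y.1))) := by
    ext ⟨L, R⟩
    simp only [Finset.mem_filter, Finset.mem_product, Finset.mem_biUnion, Finset.mem_range,
      mem_boolWords, Prod.exists, IsHalfPair, IsUpWord, IsBallotWith]
    constructor
    · rintro ⟨⟨hL, hR⟩, ⟨h1, h2⟩, h3, ⟨h4, h5⟩, h6, h7, h8⟩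
      have hcL := List.count_true_add_count_false L
      have hcR := List.count_true_add_count_false R
      refine ⟨L.count true, latePeaks i L, ⟨by omega, by omega⟩,
        ⟨hL, ⟨h1, rfl, by omega⟩, h4, h6, rfl⟩,
        hR, ⟨h2, h3.symm, by omega⟩, h5, h7, by omega⟩
    · rintro ⟨u, k, ⟨hu, hk⟩, ⟨hL, ⟨h1, h2, h3⟩, h4, h5, h6⟩, hR, ⟨h1', h2', h3'⟩, h4', h5', h6'⟩
      exact ⟨⟨hL, hR⟩, ⟨h1, h1'⟩, h2.trans h2'.symm, ⟨h4, h4'⟩, h5, h5', by omega⟩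
  rw [← Finset.sum_product', numHalfPairs]
  refine Eq.trans (by convert congrArg Finset.card hu) ?_
  rw [Finset.card_biUnion]
  · refine Finset.sum_congr rfl fun y _ => ?_
    rw [Finset.card_product]
    unfold numWords
    congr!
  · rintro ⟨u, k⟩ - ⟨v, l⟩ - hne
    rw [Function.onFun, Finset.disjoint_left]
    rintro ⟨L, R⟩ h1 h2
    simp only [Finset.mem_filter, Finset.mem_product] at h1 h2
    apply hne
    obtain ⟨⟨-, ⟨-, h3, -⟩, -, -, h4⟩, -⟩ := h1
    obtain ⟨⟨-, ⟨-, h3', -⟩, -, -, h4'⟩, -⟩ := h2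
    rw [Prod.mk.injEq]
    exact ⟨h3.symm.trans h3', h4.symm.trans h4'⟩

/-- The number of ballot words with `i` rises that end with a rise at height `r`. -/
def ballotCoeff (i r : ℤ) : ℤ := intBinom (2 * i - r - 1) (i - 1) - intBinom (2 * i - r - 1) i

lemma numWords_riseEnding_eq {i e : ℕ} (h : e < i) :
    (numWords (i + e) (IsRiseEnding i e) : ℤ) = ballotCoeff i (i - e) := by
  obtain ⟨j, rfl⟩ : ∃ j, i = j + 1 := ⟨i - 1, by omega⟩
  rw [numWords_riseEnding j e (by omega), ballotCoeff, ← intBinom_natCast, ← intBinom_natCast]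
  push_cast
  ring_nf

/-- `pathCount` in terms of the numbers of rises and falls: `e = i - r` falls before the `i`-th
rise, and final height `h = 2 * u - n`. -/
lemma pathCount_eq_upCount {n i e k u : ℤ} (hk : 0 ≤ k) (he : e < i) (hn : 2 * i ≤ n) :
    pathCount k (i - e) (2 * u - n) (n - 2 * i + (i - e)) = upCount i e k u (n - u) := by
  unfold pathCount upCount
  rw [show n - 2 * i + (i - e) + (2 * u - n) - (i - e) = 2 * (u - i) by ring,
    show n - 2 * i + (i - e) - (2 * u - n) + (i - e) = 2 * (n - u - e) by ring,
    show n - 2 * i + (i - e) - (2 * u - n) - (i - e) = 2 * (n - u - i) by ring,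
    show n - 2 * i + (i - e) + (2 * u - n) + (i - e) = 2 * (u - e) by ring]
  simp only [Int.mul_ediv_cancel_left _ (two_ne_zero : (2 : ℤ) ≠ 0)]
  by_cases h : 1 ≤ k
  · rw [if_pos h, if_pos h]
  · rw [if_neg h, if_neg h]
    exact if_congr (by omega) rfl rfl

lemma numWords_isUpWord_eq {n i k u : ℕ} (hn : 2 * i ≤ n) (hu : n < 2 * u) (hu' : u ≤ n) :
    (numWords n (IsUpWord i k u (n - u)) : ℤ) =
      ∑ r ∈ Finset.Icc (1 : ℤ) i,
        ballotCoeff i r * pathCount k r (2 * u - n) (n - 2 * i + r) := by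
  have h := (numUp_and_numDown i u (n - u) k (by omega)).1
  rw [show u + (n - u) = n by omega] at h
  rw [h]
  refine Finset.sum_bij' (fun e _ => (i : ℤ) - e) (fun r _ => (i - r).toNat) ?_ ?_ ?_ ?_ ?_
  · intro e he
    rw [Finset.mem_range] at he
    rw [Finset.mem_Icc]
    omega
  · intro r hr
    rw [Finset.mem_Icc] at hr
    rw [Finset.mem_range]
    omega
  · intro e he
    simp
  · intro r hr
    rw [Finset.mem_Icc] at hr
    omega
  · intro e he
    rw [Finset.mem_range] at he
    rw [numWords_riseEnding_eq he, pathCount_eq_upCount (by omega) (by omega) (by omega),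
      Nat.cast_sub hu']

lemma numWords_isUpWord_eq_zero {n i k u : ℕ} (hu : 2 * u ≤ n) :
    numWords n (IsUpWord i k u (n - u)) = 0 := by
  apply numWords_eq_zero
  rintro l ⟨h, h1, -, -⟩
  have := h.lt h1
  omega

lemma numHalfPairs_eq_ballotCoeff_sum {n i : ℕ} :
    (numHalfPairs n i : ℤ) = ∑ r ∈ Finset.Icc (1 : ℤ) i, ∑ s ∈ Finset.Icc (1 : ℤ) i,
      ballotCoeff i r * ballotCoeff i s *
        ∑ h ∈ (Finset.Icc (1 : ℤ) (n : ℤ)).filter (fun h : ℤ => Even ((n : ℤ) - h)),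
          ∑ k ∈ Finset.Icc (0 : ℤ) ((n : ℤ) - 2 * i),
            pathCount k r h ((n : ℤ) - 2 * i + r) *
              pathCount ((n : ℤ) - 2 * i - k) s h ((n : ℤ) - 2 * i + s) := by
  rcases lt_or_ge n (2 * i) with h | h
  · rw [numHalfPairs_eq_zero h, Finset.Icc_eq_empty (a := (0 : ℤ)) (by omega)]
    simp
  have hk : ∀ F : ℤ → ℤ, ∑ k ∈ Finset.Icc (0 : ℤ) ((n : ℤ) - 2 * i), F k =
      ∑ k ∈ Finset.range (n - 2 * i + 1), F k := fun F => by
    refine Finset.sum_bij' (fun k _ => k.toNat) (fun k _ => (k : ℤ)) ?_ ?_ ?_ ?_ ?_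
    all_goals
      intro k hk
      simp only [Finset.mem_Icc, Finset.mem_range] at hk ⊢
      try omega
    rw [Int.toNat_of_nonneg hk.1]
  have hh : ∀ F : ℤ → ℤ,
      ∑ h ∈ (Finset.Icc (1 : ℤ) (n : ℤ)).filter (fun h : ℤ => Even ((n : ℤ) - h)),
      F h = ∑ u ∈ (Finset.range (n + 1)).filter (fun u => n < 2 * u), F (2 * u - n) := fun F => by
    refine Finset.sum_bij' (fun h _ => ((n + h) / 2).toNat) (fun u _ => (2 * u - n : ℤ))
      ?_ ?_ ?_ ?_ ?_
    all_goals
      intro k hk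
      simp only [Finset.mem_Icc, Finset.mem_range, Finset.mem_filter, Int.even_iff] at hk ⊢
      try omega
    congr 1
    omega
  have h1 : (numHalfPairs n i : ℤ) = ∑ u ∈ (Finset.range (n + 1)).filter (fun u => n < 2 * u),
      ∑ k ∈ Finset.range (n - 2 * i + 1),
        (∑ r ∈ Finset.Icc (1 : ℤ) i,
          ballotCoeff i r * pathCount k r (2 * u - n) (n - 2 * i + r)) *
        (∑ s ∈ Finset.Icc (1 : ℤ) i,
          ballotCoeff i s * pathCount (n - 2 * i - k) s (2 * u - n) (n - 2 * i + s)) := by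
    rw [numHalfPairs_eq_sum h, Finset.sum_filter]
    push_cast
    refine Finset.sum_congr rfl fun u hu => ?_
    rw [Finset.mem_range] at hu
    split_ifs with h2
    · refine Finset.sum_congr rfl fun k hk => ?_
      rw [Finset.mem_range] at hk
      rw [numWords_isUpWord_eq h h2 (by omega), numWords_isUpWord_eq h h2 (by omega),
        Nat.cast_sub (by omega), Nat.cast_sub h]
      push_cast
      rfl
    · rw [Finset.sum_eq_zero]
      intro k _
      rw [numWords_isUpWord_eq_zero (by omega)]
      simp
  rw [h1]
  simp only [hk, hh, Finset.sum_mul_sum]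
  simp only [Finset.mul_sum]
  rw [Finset.sum_congr rfl fun u _ => Finset.sum_comm]
  rw [Finset.sum_comm]
  refine Finset.sum_congr rfl fun r _ => ?_
  rw [Finset.sum_congr rfl fun u _ => Finset.sum_comm]
  rw [Finset.sum_comm]
  refine Finset.sum_congr rfl fun s _ => Finset.sum_congr rfl fun u _ =>
    Finset.sum_congr rfl fun k _ => ?_
  ring

theorem mainTheorem2 (n : ℕ) :
    (avoidersWithFixedPoints n 2 pattern123 : ℤ) =
      ∑ i ∈ Finset.Icc (1 : ℤ) ((n : ℤ) - 1),
        ∑ r ∈ Finset.Icc (1 : ℤ) i, ∑ s ∈ Finset.Icc (1 : ℤ) i,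
          (intBinom (2 * i - r - 1) (i - 1) - intBinom (2 * i - r - 1) i) *
          (intBinom (2 * i - s - 1) (i - 1) - intBinom (2 * i - s - 1) i) *
          ∑ h ∈ (Finset.Icc (1 : ℤ) (n : ℤ)).filter (fun h : ℤ => Even ((n : ℤ) - h)),
            ∑ k ∈ Finset.Icc (0 : ℤ) ((n : ℤ) - 2 * i),
              pathCount k r h ((n : ℤ) - 2 * i + r) *
              pathCount ((n : ℤ) - 2 * i - k) s h ((n : ℤ) - 2 * i + s) := by
  rw [avoidersWithFixedPoints_eq_sum, Fin.sum_univ_eq_sum_range (fun b => numHalfPairs n (n - b)) n]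
  push_cast
  have h1 : ∑ b ∈ Finset.range n, (numHalfPairs n (n - b) : ℤ) =
      ∑ i ∈ Finset.Icc (1 : ℤ) n, (numHalfPairs n i.toNat : ℤ) := by
    refine Finset.sum_bij' (fun b _ => (n - b : ℤ)) (fun i _ => (n - i).toNat) ?_ ?_ ?_ ?_ ?_
    all_goals
      intro b hb
      simp only [Finset.mem_Icc, Finset.mem_range] at hb ⊢
      try omega
    congr 2
    omega
  -- the term `i = n`, that is `b = 0`, vanishes
  have h2 : ∑ i ∈ Finset.Icc (1 : ℤ) (n - 1), (numHalfPairs n i.toNat : ℤ) =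
      ∑ i ∈ Finset.Icc (1 : ℤ) n, (numHalfPairs n i.toNat : ℤ) := by
    refine Finset.sum_subset (Finset.Icc_subset_Icc_right (by omega)) fun i hi hi' => ?_
    rw [Finset.mem_Icc] at hi hi'
    rw [numHalfPairs_eq_zero (by omega), Nat.cast_zero]
  rw [h1, ← h2]
  refine Finset.sum_congr rfl fun i hi => ?_
  rw [Finset.mem_Icc] at hi
  rw [numHalfPairs_eq_ballotCoeff_sum, Int.toNat_of_nonneg (by omega)]
  rfl
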